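/- All digraphs are finite and simple: there are no loops, and there is at most one edge between any two vertices (in particular, no directed $2$-cycle). For a digraph $G$ in which every vertex has in-degree $\deg^{in}(v)\ge 1$, a set $M\subseteq V(G)$ is a \emph{strict majority dynamic monopoly} if $V(G)$ can be partitioned into $D_0\cup D_1\cup\dots\cup D_t$ such that $D_0=M$ and, for every $i\ge 1$ and every $v\in D_i$, the number of edges from $D_0\cup\dots\cup D_{i-1}$ to $v$ is at least $\lceil(\deg^{in}(v)+1)/2\rceil$. There exist a (deterministic) algorithm $A$ and a polynomial $p$ such that, for every simple digraph $G$ on the vertex set $\{0,\dots,n-1\}$ with positive minimum in-degree, given by $n$ and its adjacency matrix, $A$ halts on $G$ after at most $p(n)$ steps and outputs a strict majority dynamic monopoly of $G$ of cardinality at most $|G|/2 = n/2$. (The steps are those of a random access machine with unit-cost memory access, addition, truncated subtraction and test for zero, a model that is polynomially equivalent to Turing machines.) -/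

import Mathlib

/-! ### Dynamic monopolies in directed graphs -/

namespace DynMon

/-- A digraph is simple if it has no loop and at most one edge between any two vertices
(in particular, no directed cycle of length two). -/
structure IsSimple {V : Type*} (G : Digraph V) : Prop where
  no_loop : ∀ v, ¬ G.Adj v v
  no_two_cycle : ∀ u v, G.Adj u v → ¬ G.Adj v u

open Classical in
/-- The number of edges from `S` to `v`. -/
noncomputable def edgesFrom {V : Type*} (G : Digraph V) (S : Finset V) (v : V) : ℕ :=
  (S.filter fun u => G.Adj u v).card

/-- The in-degree of `v`. -/
noncomputable def inDegree {V : Type*} [Fintype V] (G : Digraph V) (v : V) : ℕ :=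
  edgesFrom G Finset.univ v

open Classical in
/-- `M` is a dynamic monopoly for `(G, τ)`: the vertex set is partitioned into `D 0, …, D t` with
`D 0 = M`, and every `v ∈ D i`, `i ≥ 1`, receives at least `τ v` edges from
`D 0 ∪ … ∪ D (i - 1)`. -/
def IsDynamicMonopoly {V : Type*} [Fintype V] (G : Digraph V) (τ : V → ℕ) (M : Finset V) : Prop :=
  ∃ (t : ℕ) (D : ℕ → Finset V),
    (∀ i ≤ t, ∀ j ≤ t, i ≠ j → Disjoint (D i) (D j)) ∧
    (∀ v, ∃ i ≤ t, v ∈ D i) ∧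
    D 0 = M ∧
    ∀ i, 1 ≤ i → i ≤ t → ∀ v ∈ D i, τ v ≤ edgesFrom G ((Finset.range i).biUnion D) v

/-- The strict majority threshold `⌈(deg⁻(v) + 1) / 2⌉`. -/
noncomputable def strictMajority {V : Type*} [Fintype V] (G : Digraph V) (v : V) : ℕ :=
  ⌈((inDegree G v : ℚ) + 1) / 2⌉₊

/-- A strict majority dynamic monopoly. -/
def IsStrictMajorityDynamo {V : Type*} [Fintype V] (G : Digraph V) (M : Finset V) : Prop :=
  IsDynamicMonopoly G (strictMajority G) M

end DynMon

/-! ### Random access machines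

Algorithms are deterministic structured programs for a random access machine whose memory consists
of arrays of natural numbers, with indirect addressing. The only arithmetic operations are
addition and truncated subtraction (no multiplication), so that unit cost per operation is
polynomially equivalent to the time of a Turing machine. -/

namespace RAM

/-- The memory: `s a i` is the content of cell `i` of array `a`. A program mentions only finitely
many arrays. -/
def Store : Type := ℕ → ℕ → ℕ

/-- The store `s` with `x` written into cell `i` of array `a`. -/
def Store.write (s : Store) (a i x : ℕ) : Store :=
  fun b j => if b = a ∧ j = i then x else s b j

/-- Expressions: constants, cell `e` of the array `a`, sum, truncated difference. -/
inductive Expr : Type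
  | const (c : ℕ)
  | read (a : ℕ) (e : Expr)
  | add (e₁ e₂ : Expr)
  | sub (e₁ e₂ : Expr)

/-- The value of an expression. -/
def Expr.eval : Expr → Store → ℕ
  | .const c, _ => c
  | .read a e, s => s a (e.eval s)
  | .add e₁ e₂, s => e₁.eval s + e₂.eval s
  | .sub e₁ e₂, s => e₁.eval s - e₂.eval s

/-- The number of steps that the evaluation of an expression takes: one for each constant loaded,
each memory access and each arithmetic operation. -/
def Expr.cost : Expr → ℕ
  | .const _ => 1
  | .read _ e => e.cost + 1
  | .add e₁ e₂ => e₁.cost + e₂.cost + 1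
  | .sub e₁ e₂ => e₁.cost + e₂.cost + 1

/-- Programs. A condition `e` counts as true if its value is not `0`. -/
inductive Prog : Type
  | skip
  | assign (a : ℕ) (i e : Expr)
  | seq (c₁ c₂ : Prog)
  | ite (e : Expr) (c₁ c₂ : Prog)
  | loop (e : Expr) (c : Prog)

/-- `Exec c s s' t`: started on the store `s`, the program `c` halts after exactly `t` steps,
with final store `s'`. -/
inductive Exec : Prog → Store → Store → ℕ → Prop
  | skip (s : Store) : Exec .skip s s 1
  | assign (a : ℕ) (i e : Expr) (s : Store) :
      Exec (.assign a i e) s (s.write a (i.eval s) (e.eval s)) (i.cost + e.cost + 1)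
  | seq {c₁ c₂ : Prog} {s s' s'' : Store} {t₁ t₂ : ℕ} :
      Exec c₁ s s' t₁ → Exec c₂ s' s'' t₂ → Exec (.seq c₁ c₂) s s'' (t₁ + t₂)
  | ite_true {e : Expr} {c₁ c₂ : Prog} {s s' : Store} {t : ℕ} :
      e.eval s ≠ 0 → Exec c₁ s s' t → Exec (.ite e c₁ c₂) s s' (e.cost + 1 + t)
  | ite_false {e : Expr} {c₁ c₂ : Prog} {s s' : Store} {t : ℕ} :
      e.eval s = 0 → Exec c₂ s s' t → Exec (.ite e c₁ c₂) s s' (e.cost + 1 + t)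
  | loop_true {e : Expr} {c : Prog} {s s' s'' : Store} {t₁ t₂ : ℕ} :
      e.eval s ≠ 0 → Exec c s s' t₁ → Exec (.loop e c) s' s'' t₂ →
      Exec (.loop e c) s s'' (e.cost + 1 + t₁ + t₂)
  | loop_false {e : Expr} {c : Prog} {s : Store} :
      e.eval s = 0 → Exec (.loop e c) s s (e.cost + 1)

/-- The final store and the number of steps are determined by the program and the input. -/
theorem Exec.deterministic {c : Prog} {s s₁ s₂ : Store} {t₁ t₂ : ℕ}
    (h₁ : Exec c s s₁ t₁) (h₂ : Exec c s s₂ t₂) : s₁ = s₂ ∧ t₁ = t₂ := by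
  induction h₁ generalizing s₂ t₂ with
  | skip s => cases h₂; exact ⟨rfl, rfl⟩
  | assign a i e s => cases h₂; exact ⟨rfl, rfl⟩
  | seq _ _ ih₁ ih₂ =>
    cases h₂ with
    | seq a b =>
      obtain ⟨rfl, rfl⟩ := ih₁ a
      obtain ⟨rfl, rfl⟩ := ih₂ b
      exact ⟨rfl, rfl⟩
  | ite_true h _ ih =>
    cases h₂ with
    | ite_true _ b => obtain ⟨rfl, rfl⟩ := ih b; exact ⟨rfl, rfl⟩
    | ite_false a _ => exact absurd a h
  | ite_false h _ ih =>
    cases h₂ with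
    | ite_true a _ => exact absurd h a
    | ite_false _ b => obtain ⟨rfl, rfl⟩ := ih b; exact ⟨rfl, rfl⟩
  | loop_true h _ _ ih₁ ih₂ =>
    cases h₂ with
    | loop_true _ a b =>
      obtain ⟨rfl, rfl⟩ := ih₁ a
      obtain ⟨rfl, rfl⟩ := ih₂ b
      exact ⟨rfl, rfl⟩
    | loop_false a => exact absurd a h
  | loop_false h =>
    cases h₂ with
    | loop_true a _ _ => exact absurd h a
    | loop_false _ => exact ⟨rfl, rfl⟩

open Classical in
/-- The input that describes a digraph `G` with vertices `0, …, n - 1`: array `0` holds `n` in its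
cell `0`, array `1` holds the adjacency matrix of `G` row by row (the entry of the pair `(u, v)` is
in cell `u * n + v`), and all other cells are `0`. -/
noncomputable def inputStore {n : ℕ} (G : Digraph (Fin n)) : Store := fun a i =>
  if a = 0 ∧ i = 0 then n
  else if a = 1 ∧ ∃ u v : Fin n, i = (u : ℕ) * n + (v : ℕ) ∧ G.Adj u v then 1
  else 0

/-- The output that a final store holds: the set of the vertices `v` with a nonzero entry in cell
`v` of array `2`. -/
def outputSet (n : ℕ) (s : Store) : Finset (Fin n) :=
  Finset.univ.filter fun v => s 2 (v : ℕ) ≠ 0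

end RAM

/-!
A colour class is called degenerate if every nonempty set of its vertices has a member fewer than
half of whose in-neighbours lie in the set. The complement of a degenerate class is a strict
majority dynamic monopoly (`isStrictMajorityDynamo_of_isDegenerate`): the vertices of the class can
be activated one by one. So it suffices to colour all vertices with two colours, both of whose
classes are degenerate, and to output the smaller class.

An uncoloured vertex `v` can be given a colour that fewer than half of its in-neighbours have. If it
is stuck, then exactly half of its in-neighbours have colour `1` and half have colour `2`. In that
case an in-neighbour `x` of `v` may pass its colour on to `v` and become uncoloured instead: since
`x` has left the class, `v` sees fewer than half of its in-neighbours in it, and the classes remain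
degenerate (`IsValid.advance`). Thus the uncoloured vertex, marked by a token, can be moved at will
against the direction of the edges.

The token starts at `X 0` and is led along a path `X 0, X 1, …, X l`, where `X (i + 1)` is an
in-neighbour of `X i`, that cannot be extended: all in-neighbours of `X l` lie on it. Let `j` be the
largest index of an in-neighbour of `X l`. As the digraph is simple, `j ≤ l - 2`. Suppose that the
vertex with the token never gets coloured. A tour of the token around the cycle `X j, …, X l`
rotates the colours of `X j, …, X (l - 1)`, while `X j` is the only in-neighbour of `X l` on the
cycle. Since `X l` is stuck before and after each tour, the colour of `X j` does not change, and so
all of `X j, …, X (l - 1)` have the same colour `a` (`colour_eq_of_iterate_tour`). Half of the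
in-neighbours of `X l` have the other colour; let `X i` be one of them. A tour that starts at `X i`
leaves the other colour on `X (l - 1)` and the colour `a` on `X j`, a contradiction
(`not_isOpen_settle`).

The algorithm treats all vertices in this way. It only has loops of the form `for i = 0, …, n - 1`,
and programs of this kind (`ForProg`) halt in polynomial time (`ForProg.IsWellFormed.exec`).
-/

namespace DynMon

/-! ### Colourings and the moving token -/

/-- A colouring of the vertices (`0` stands for "uncoloured", the two colours are `1` and `2`)
together with the vertex that carries the token. -/
abbrev Config : Type := (ℕ → ℕ) × ℕ

open Classical in
/-- The in-neighbours of `v` in the digraph `A` on `{0, …, n - 1}`. -/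
noncomputable def inNbrs (A : ℕ → ℕ → Prop) (n v : ℕ) : Finset ℕ :=
  (Finset.range n).filter fun u => A u v

/-- The number of in-neighbours of `v` of colour `c`. -/
noncomputable def colourCount (A : ℕ → ℕ → Prop) (n : ℕ) (col : ℕ → ℕ) (c v : ℕ) : ℕ :=
  ((inNbrs A n v).filter fun u => col u = c).card

/-- The token lies on an uncoloured vertex. -/
def IsOpen (σ : Config) : Prop := σ.1 σ.2 = 0

/-- The token lies on an uncoloured vertex that cannot be given either colour, since each colour
occurs on at least half of its in-neighbours. -/
def IsStuck (A : ℕ → ℕ → Prop) (n : ℕ) (σ : Config) : Prop :=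
  σ.1 σ.2 = 0 ∧ (inNbrs A n σ.2).card ≤ 2 * colourCount A n σ.1 1 σ.2 ∧
    (inNbrs A n σ.2).card ≤ 2 * colourCount A n σ.1 2 σ.2

open Classical in
/-- One step of the algorithm. If the vertex `v` with the token is uncoloured, it gets a colour
that fewer than half of its in-neighbours have; if there is none and `x` is an in-neighbour of `v`,
then the colour of `x` and the token change places. -/
noncomputable def advance (A : ℕ → ℕ → Prop) (n x : ℕ) (σ : Config) : Config :=
  if σ.1 σ.2 = 0 then
    if 2 * colourCount A n σ.1 1 σ.2 < (inNbrs A n σ.2).card then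
      (Function.update σ.1 σ.2 1, σ.2)
    else if 2 * colourCount A n σ.1 2 σ.2 < (inNbrs A n σ.2).card then
      (Function.update σ.1 σ.2 2, σ.2)
    else if A x σ.2 then
      (Function.update (Function.update σ.1 σ.2 (σ.1 x)) x 0, x)
    else σ
  else σ

open Classical in
/-- The token is led along the vertices `X i, X (i + 1), …, X l`; only those with index less
than `k` are used. -/
noncomputable def sweep (A : ℕ → ℕ → Prop) (n : ℕ) (X : ℕ → ℕ) (l i : ℕ) :
    ℕ → Config → Config
  | 0, σ => σ
  | k + 1, σ =>
    if i ≤ k ∧ k ≤ l then advance A n (X k) (sweep A n X l i k σ) else sweep A n X l i k σ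

/-- The token is led along `X i, X (i + 1), …, X l`, and an attempt is made to colour the vertex
where it arrives. -/
noncomputable def tour (A : ℕ → ℕ → Prop) (n : ℕ) (X : ℕ → ℕ) (l i : ℕ) (σ : Config) : Config :=
  advance A n (X l) (sweep A n X l i n σ)

open Classical in
/-- If `X i` is an in-neighbour of `X l` that differs in colour from `X j`, then one tour starts
at `X i`, and `n` tours at `X j`. -/
noncomputable def detour (A : ℕ → ℕ → Prop) (n : ℕ) (X : ℕ → ℕ) (l j i : ℕ) (σ : Config) :
    Config :=
  if i < l ∧ A (X i) (X l) ∧ σ.1 (X i) ≠ σ.1 (X j) then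
    (tour A n X l j)^[n] (tour A n X l i σ)
  else σ

/-- The detours with index less than `k`, one after the other. -/
noncomputable def detours (A : ℕ → ℕ → Prop) (n : ℕ) (X : ℕ → ℕ) (l j : ℕ) :
    ℕ → Config → Config
  | 0, σ => σ
  | k + 1, σ => detour A n X l j k (detours A n X l j k σ)

/-- The whole treatment of a token that starts on `X 0`. -/
noncomputable def settle (A : ℕ → ℕ → Prop) (n : ℕ) (X : ℕ → ℕ) (l j : ℕ) (σ : Config) :
    Config :=
  detours A n X l j n ((tour A n X l j)^[n] (tour A n X l 0 σ))

/-- `X 0, …, X l` is a path, traversed against the direction of its edges, that cannot be extended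
beyond `X l`. -/
structure IsMaximalPath (A : ℕ → ℕ → Prop) (n : ℕ) (X : ℕ → ℕ) (l : ℕ) : Prop where
  lt : ∀ i ≤ l, X i < n
  inj : ∀ i ≤ l, ∀ j ≤ l, X i = X j → i = j
  adj : ∀ i < l, A (X (i + 1)) (X i)
  maximal : ∀ y, A y (X l) → ∃ i < l, X i = y

/-! ### Single steps -/

section Advance

variable {A : ℕ → ℕ → Prop} {n x : ℕ} {σ : Config}

theorem advance_of_not_isOpen (h : ¬ IsOpen σ) : advance A n x σ = σ := if_neg h

theorem IsOpen.of_advance (h : IsOpen (advance A n x σ)) : IsOpen σ := by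
  by_contra h'
  rw [advance_of_not_isOpen h'] at h
  exact h' h

theorem IsOpen.isStuck_of_advance (h : IsOpen (advance A n x σ)) : IsStuck A n σ := by
  have h0 := h.of_advance
  have h0' : σ.1 σ.2 = 0 := h0
  refine ⟨h0, ?_⟩
  by_contra hc
  have : ¬ IsOpen (advance A n x σ) := by
    unfold advance IsOpen
    rw [if_pos h0']
    split_ifs with h1 h2
    · simp
    · simp
    · exact absurd ⟨not_lt.1 h1, not_lt.1 h2⟩ hc
    · exact absurd ⟨not_lt.1 h1, not_lt.1 h2⟩ hc
  exact this h

theorem IsStuck.advance_eq (h : IsStuck A n σ) (hx : A x σ.2) :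
    advance A n x σ = (Function.update (Function.update σ.1 σ.2 (σ.1 x)) x 0, x) := by
  unfold advance
  rw [if_pos h.1, if_neg (not_lt.2 h.2.1), if_neg (not_lt.2 h.2.2), if_pos hx]

theorem IsStuck.advance_eq_self (h : IsStuck A n σ) (hx : ¬ A x σ.2) :
    advance A n x σ = σ := by
  unfold advance
  rw [if_pos h.1, if_neg (not_lt.2 h.2.1), if_neg (not_lt.2 h.2.2), if_neg hx]

theorem colourCount_add_le (col : ℕ → ℕ) {c c' : ℕ} (h : c ≠ c') (v : ℕ) :
    colourCount A n col c v + colourCount A n col c' v ≤ (inNbrs A n v).card := by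
  unfold colourCount
  rw [← Finset.card_union_of_disjoint]
  · exact Finset.card_le_card (by intro; simp; tauto)
  · rw [Finset.disjoint_left]
    intro a ha hb
    simp only [Finset.mem_filter] at ha hb
    exact h (ha.2.symm.trans hb.2)

/-- At a stuck token each colour occurs on exactly half of the in-neighbours. -/
theorem IsStuck.two_mul_colourCount (h : IsStuck A n σ) {c : ℕ} (hc : c = 1 ∨ c = 2) :
    2 * colourCount A n σ.1 c σ.2 = (inNbrs A n σ.2).card := by
  have h1 := h.2.1
  have h2 := h.2.2
  have h3 := colourCount_add_le (A := A) (n := n) σ.1 (show (1 : ℕ) ≠ 2 by decide) σ.2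
  rcases hc with rfl | rfl <;> omega

/-- At a stuck token all in-neighbours are coloured. -/
theorem IsStuck.colour (h : IsStuck A n σ) {y : ℕ} (hy : y ∈ inNbrs A n σ.2) :
    σ.1 y = 1 ∨ σ.1 y = 2 := by
  by_contra hc
  push Not at hc
  have h1 := h.two_mul_colourCount (Or.inl rfl)
  have h2 := h.two_mul_colourCount (Or.inr rfl)
  have h3 : colourCount A n σ.1 1 σ.2 + colourCount A n σ.1 2 σ.2 < (inNbrs A n σ.2).card := by
    unfold colourCount
    rw [← Finset.card_union_of_disjoint]
    · refine Finset.card_lt_card ⟨by intro; simp; tauto, fun hs => ?_⟩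
      have := hs hy
      simp only [Finset.mem_union, Finset.mem_filter] at this
      tauto
    · rw [Finset.disjoint_left]
      intro a ha hb
      simp only [Finset.mem_filter] at ha hb
      omega
  omega

end Advance

/-! ### Tours of the token -/

section Tours

variable {A : ℕ → ℕ → Prop} {n : ℕ} {X : ℕ → ℕ} {l : ℕ}

theorem sweep_of_not_isOpen {i k : ℕ} {σ : Config} (h : ¬ IsOpen σ) :
    sweep A n X l i k σ = σ := by
  induction k with
  | zero => rfl
  | succ k ih => simp only [sweep, ih, advance_of_not_isOpen h, ite_self]

theorem tour_of_not_isOpen {i : ℕ} {σ : Config} (h : ¬ IsOpen σ) : tour A n X l i σ = σ := by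
  rw [tour, sweep_of_not_isOpen h, advance_of_not_isOpen h]

theorem iterate_tour_of_not_isOpen {i : ℕ} {σ : Config} (h : ¬ IsOpen σ) (m : ℕ) :
    (tour A n X l i)^[m] σ = σ :=
  Function.iterate_fixed (tour_of_not_isOpen h) m

theorem detour_of_not_isOpen {j i : ℕ} {σ : Config} (h : ¬ IsOpen σ) :
    detour A n X l j i σ = σ := by
  rw [detour, tour_of_not_isOpen h, iterate_tour_of_not_isOpen h, ite_self]

theorem detours_of_not_isOpen {j k : ℕ} {σ : Config} (h : ¬ IsOpen σ) :
    detours A n X l j k σ = σ := by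
  induction k with
  | zero => rfl
  | succ k ih => rw [detours, ih, detour_of_not_isOpen h]

theorem IsOpen.of_iterate_tour {i m : ℕ} {σ : Config}
    (h : IsOpen ((tour A n X l i)^[m] σ)) : IsOpen σ := by
  by_contra h'
  rw [iterate_tour_of_not_isOpen h'] at h
  exact h' h

theorem sweep_eq_of_le {i k : ℕ} (hk : k ≤ i) (σ : Config) : sweep A n X l i k σ = σ := by
  induction k with
  | zero => rfl
  | succ k ih => rw [sweep, if_neg (by omega), ih (by omega)]

theorem sweep_succ_self {i : ℕ} (hi : i ≤ l) (σ : Config) :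
    sweep A n X l i (i + 1) σ = advance A n (X i) σ := by
  rw [sweep, if_pos ⟨le_rfl, hi⟩, sweep_eq_of_le le_rfl]

theorem sweep_eq_of_lt {i k : ℕ} (hk : l + 1 ≤ k) (σ : Config) :
    sweep A n X l i k σ = sweep A n X l i (l + 1) σ := by
  induction k, hk using Nat.le_induction with
  | base => rfl
  | succ k hk ih => rw [sweep, if_neg (by omega), ih]

theorem tour_eq (hl : l < n) (i : ℕ) (σ : Config) :
    tour A n X l i σ = advance A n (X l) (sweep A n X l i (l + 1) σ) := by
  rw [tour, sweep_eq_of_lt (by omega : l + 1 ≤ n)]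

/-- While the token moves along the path, all colours that it passes move back by one place. -/
theorem sweep_apply (hX : IsMaximalPath A n X l) {i : ℕ} (hi : i ≤ l) {σ : Config} {g : ℕ → ℕ}
    (hg : advance A n (X i) σ = (g, X i)) (t : ℕ) (ht : i + t ≤ l)
    (ho : IsOpen (sweep A n X l i (i + t + 1) σ)) :
    (sweep A n X l i (i + t + 1) σ).2 = X (i + t) ∧
      (∀ r < t, (sweep A n X l i (i + t + 1) σ).1 (X (i + r)) = g (X (i + r + 1))) ∧
      ∀ w, (∀ r ≤ t, w ≠ X (i + r)) → (sweep A n X l i (i + t + 1) σ).1 w = g w := by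
  induction t with
  | zero =>
    rw [Nat.add_zero, sweep_succ_self hi, hg]
    exact ⟨rfl, fun r hr => absurd hr (by omega), fun w _ => rfl⟩
  | succ t ih =>
    have hs : sweep A n X l i (i + (t + 1) + 1) σ =
        advance A n (X (i + t + 1)) (sweep A n X l i (i + t + 1) σ) := by
      rw [sweep, if_pos ⟨by omega, by omega⟩]; rfl
    rw [hs] at ho ⊢
    obtain ⟨h1, h2, h3⟩ := ih (by omega) ho.of_advance
    have hadj : A (X (i + t + 1)) (sweep A n X l i (i + t + 1) σ).2 := by
      rw [h1]; exact hX.adj _ (by omega)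
    have hne : ∀ r ≤ t, X (i + t + 1) ≠ X (i + r) := fun r hr h => by
      have := hX.inj _ (by omega) _ (by omega) h
      omega
    rw [ho.isStuck_of_advance.advance_eq hadj, h1]
    refine ⟨rfl, fun r hr => ?_, fun w hw => ?_⟩
    · have hr1 : X (i + r) ≠ X (i + t + 1) := (hne r (by omega)).symm
      simp only [Function.update_of_ne hr1]
      rcases Nat.lt_succ_iff_lt_or_eq.1 hr with hr | rfl
      · rw [Function.update_of_ne, h2 r hr]
        intro h
        have := hX.inj _ (by omega) _ (by omega) h
        omega
      · rw [Function.update_self, h3 _ hne]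
    · have : w ≠ X (i + t + 1) := hw (t + 1) le_rfl
      simp only
      rw [Function.update_of_ne this, Function.update_of_ne (hw t (by omega)),
        h3 w fun r hr => hw r (by omega)]

/-- The effect of a tour, in terms of the configuration just after its first step. -/
theorem tour_apply (hirr : ∀ v, ¬ A v v) (hX : IsMaximalPath A n X l) (hl : l < n) {i : ℕ}
    (hi : i ≤ l) {σ : Config} {g : ℕ → ℕ} (hg : advance A n (X i) σ = (g, X i))
    (ho : IsOpen (tour A n X l i σ)) :
    IsStuck A n (tour A n X l i σ) ∧ (tour A n X l i σ).2 = X l ∧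
      (∀ r, i ≤ r → r < l → (tour A n X l i σ).1 (X r) = g (X (r + 1))) ∧
      ∀ r < i, (tour A n X l i σ).1 (X r) = g (X r) := by
  rw [tour_eq hl] at ho ⊢
  obtain ⟨t, rfl⟩ := Nat.exists_eq_add_of_le hi
  obtain ⟨h1, h2, h3⟩ := sweep_apply hX hi hg t le_rfl ho.of_advance
  have hs := ho.isStuck_of_advance
  rw [hs.advance_eq_self (by rw [h1]; exact hirr _)]
  refine ⟨hs, h1, fun r hr hrl => ?_, fun r hr => h3 _ fun r' hr' h => ?_⟩
  · obtain ⟨r, rfl⟩ := Nat.exists_eq_add_of_le hr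
    exact h2 r (by omega)
  · have := hX.inj _ (by omega) _ (by omega) h
    omega

/-- A tour that starts at an in-neighbour `X i` of `X l`, with the token on `X l`, rotates the
colours of `X i, …, X (l - 1)`. -/
theorem tour_rotates (hirr : ∀ v, ¬ A v v) (hX : IsMaximalPath A n X l) (hl : l < n) {i : ℕ}
    (hi : i < l) {σ : Config} (hσ : σ.2 = X l) (hs : IsStuck A n σ) (hA : A (X i) (X l))
    (ho : IsOpen (tour A n X l i σ)) :
    IsStuck A n (tour A n X l i σ) ∧ (tour A n X l i σ).2 = X l ∧
      (∀ r, i ≤ r → r + 1 < l → (tour A n X l i σ).1 (X r) = σ.1 (X (r + 1))) ∧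
      (tour A n X l i σ).1 (X (l - 1)) = σ.1 (X i) ∧
      ∀ r < i, (tour A n X l i σ).1 (X r) = σ.1 (X r) := by
  have hg := hs.advance_eq (by rw [hσ]; exact hA : A (X i) σ.2)
  obtain ⟨h1, h2, h3, h4⟩ := tour_apply hirr hX hl hi.le hg ho
  have hne : ∀ r ≤ l, ∀ r' ≤ l, r ≠ r' → X r ≠ X r' := fun r hr r' hr' h h' =>
    h (hX.inj r hr r' hr' h')
  refine ⟨h1, h2, fun r hr hrl => ?_, ?_, fun r hr => ?_⟩
  · rw [h3 r hr (by omega), hσ, Function.update_of_ne (hne _ (by omega) _ (by omega) (by omega)),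
      Function.update_of_ne (hne _ (by omega) _ (by omega) (by omega))]
  · rw [h3 (l - 1) (by omega) (by omega), Nat.sub_add_cancel (by omega), hσ,
      Function.update_of_ne (hne _ (by omega) _ (by omega) (by omega)), Function.update_self]
  · rw [h4 r hr, hσ, Function.update_of_ne (hne _ (by omega) _ (by omega) (by omega)),
      Function.update_of_ne (hne _ (by omega) _ (by omega) (by omega))]

/-- If repeated tours around the cycle `X j, …, X l` never colour `X l`, then `X j, …, X (l - 1)`
all have the same colour: `X j` is the only in-neighbour of `X l` on the cycle, and each of these
colours comes to lie on `X j`. -/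
theorem colour_eq_of_iterate_tour (hirr : ∀ v, ¬ A v v) (hX : IsMaximalPath A n X l) (hl : l < n)
    {j : ℕ} (hj : j < l) (hA : A (X j) (X l)) (hmax : ∀ r < l, A (X r) (X l) → r ≤ j) (m : ℕ) :
    ∀ σ : Config, σ.2 = X l → IsStuck A n σ → IsOpen ((tour A n X l j)^[m] σ) →
      ∀ t ≤ m, j + t < l → σ.1 (X (j + t)) = σ.1 (X j) := by
  induction m with
  | zero => intro σ _ _ _ t ht _; rw [Nat.le_zero.1 ht, Nat.add_zero]
  | succ m ih =>
    intro σ hσ hs ho t ht htl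
    rcases t with _ | t
    · rfl
    rw [Function.iterate_succ_apply] at ho
    obtain ⟨h1, h2, h3, -, h5⟩ := tour_rotates hirr hX hl hj hσ hs hA ho.of_iterate_tour
    have key : (tour A n X l j σ).1 (X j) = σ.1 (X j) := by
      by_contra hne
      -- Otherwise the old colour of `X j` would lose exactly one in-neighbour of `X l`.
      have hmem : X j ∈ inNbrs A n (X l) := by
        simp only [inNbrs, Finset.mem_filter, Finset.mem_range]
        exact ⟨hX.lt j hj.le, hA⟩
      have hc := hs.colour (by rw [hσ]; exact hmem : X j ∈ inNbrs A n σ.2)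
      have e1 := hs.two_mul_colourCount hc
      have e2 := h1.two_mul_colourCount hc
      rw [h2] at e2
      rw [hσ] at e1
      have hlt : colourCount A n (tour A n X l j σ).1 (σ.1 (X j)) (X l) <
          colourCount A n σ.1 (σ.1 (X j)) (X l) := by
        refine Finset.card_lt_card ⟨fun y hy => ?_, fun hsub => ?_⟩
        · simp only [Finset.mem_filter] at hy ⊢
          refine ⟨hy.1, ?_⟩
          have hyA : A y (X l) := by
            have := hy.1
            simp only [inNbrs, Finset.mem_filter] at this
            exact this.2
          obtain ⟨r, hr, rfl⟩ := hX.maximal y hyA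
          rcases (hmax r hr hyA).lt_or_eq with hrj | rfl
          · rw [← h5 r hrj]; exact hy.2
          · rfl
        · have := hsub (by simp [hmem] : X j ∈ _)
          simp only [Finset.mem_filter] at this
          exact hne this.2
      omega
    have h6 := ih _ h2 h1 ho t (by omega) (by omega)
    rw [key, h3 _ (by omega) (by omega)] at h6
    exact h6

/-- The token always ends on a coloured vertex. -/
theorem not_isOpen_settle (hirr : ∀ v, ¬ A v v) (hasymm : ∀ u v, A u v → ¬ A v u)
    (hX : IsMaximalPath A n X l) (hl : l < n) {j : ℕ} (hj : j < l) (hA : A (X j) (X l))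
    (hmax : ∀ r < l, A (X r) (X l) → r ≤ j) {σ : Config} (hσ : σ.2 = X 0) :
    ¬ IsOpen (settle A n X l j σ) := by
  intro ho
  have hj2 : j + 1 < l := by
    rcases Nat.lt_or_ge (j + 1) l with h | h
    · exact h
    -- In this case the edges between `X j` and `X l` would form a cycle of length two.
    · have hjl : j + 1 = l := by omega
      have := hX.adj j hj
      rw [hjl] at this
      exact absurd hA (hasymm _ _ this)
  have uniform := fun σ h1 h2 h3 t ht =>
    colour_eq_of_iterate_tour hirr hX hl hj hA hmax n σ h1 h2 h3 t ht
  -- The first tour brings the token to `X l`.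
  set σ₁ := tour A n X l 0 σ with hσ₁
  set σ₂ := (tour A n X l j)^[n] σ₁ with hσ₂
  have ho' : IsOpen (detours A n X l j n σ₂) := ho
  have ho₂ : IsOpen σ₂ := by
    by_contra h
    rw [detours_of_not_isOpen h] at ho'
    exact h ho'
  have ho₁ : IsOpen σ₁ := ho₂.of_iterate_tour
  -- As there are no loops, the first step of this tour, to `X 0` itself, moves nothing.
  have hg : advance A n (X 0) σ = (σ.1, X 0) := by
    have ho₀ : IsStuck A n σ := by
      have : IsOpen (sweep A n X l 0 1 σ) := by
        by_contra h
        have key : ∀ k, sweep A n X l 0 (k + 1) σ = sweep A n X l 0 1 σ := by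
          intro k
          induction k with
          | zero => rfl
          | succ k ih => rw [sweep, ih, advance_of_not_isOpen h, ite_self]
        have h' := ho₁
        rw [hσ₁, tour_eq hl, key l] at h'
        exact h h'.of_advance
      rw [sweep_succ_self (Nat.zero_le _)] at this
      exact this.isStuck_of_advance
    rw [ho₀.advance_eq_self (by rw [hσ]; exact hirr _), ← hσ]
  obtain ⟨hs₁, ht₁, -, -⟩ := tour_apply hirr hX hl (Nat.zero_le _) hg ho₁
  -- The tours around the cycle keep the token at `X l`.
  have stay : ∀ m (ρ : Config), ρ.2 = X l → IsStuck A n ρ → IsOpen ((tour A n X l j)^[m] ρ) →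
      ((tour A n X l j)^[m] ρ).2 = X l ∧ IsStuck A n ((tour A n X l j)^[m] ρ) := by
    intro m
    induction m with
    | zero => intro ρ h1 h2 _; exact ⟨h1, h2⟩
    | succ m ih =>
      intro ρ h1 h2 h3
      rw [Function.iterate_succ_apply] at h3 ⊢
      obtain ⟨h4, h5, -⟩ := tour_rotates hirr hX hl hj h1 h2 hA h3.of_iterate_tour
      exact ih _ h5 h4 h3
  obtain ⟨ht₂, hs₂⟩ : σ₂.2 = X l ∧ IsStuck A n σ₂ := stay n σ₁ ht₁ hs₁ ho₂
  -- Tours around a cycle of one colour change nothing on it.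
  have rot : ∀ m (ρ : Config), ρ.2 = X l → IsStuck A n ρ → IsOpen ((tour A n X l j)^[m] ρ) →
      (∀ t, j + t < l → ρ.1 (X (j + t)) = ρ.1 (X j)) →
      ∀ t, j + t < l → ((tour A n X l j)^[m] ρ).1 (X (j + t)) = ρ.1 (X j) := by
    intro m
    induction m with
    | zero => intro ρ h1 h2 _ h; exact h
    | succ m ih =>
      intro ρ h1 h2 h3 hu
      rw [Function.iterate_succ_apply] at h3 ⊢
      obtain ⟨h4, h5, h6, h7, -⟩ := tour_rotates hirr hX hl hj h1 h2 hA h3.of_iterate_tour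
      have hall : ∀ t, j + t < l → (tour A n X l j ρ).1 (X (j + t)) = ρ.1 (X j) := by
        intro t ht
        rcases Nat.lt_or_ge (j + t + 1) l with h | h
        · rw [h6 _ (by omega) h]; exact hu (t + 1) (by omega)
        · rw [show j + t = l - 1 by omega, h7]
      have hj0 := hall 0 (by omega)
      rw [Nat.add_zero] at hj0
      intro t ht
      rw [ih _ h5 h4 h3 (fun t ht => by rw [hall t ht, hj0]) t ht, hj0]
  have huni₁ : ∀ t, j + t < l → σ₁.1 (X (j + t)) = σ₁.1 (X j) := fun t ht =>
    uniform σ₁ ht₁ hs₁ ho₂ t (by omega) ht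
  have huni₂ : ∀ t, j + t < l → σ₂.1 (X (j + t)) = σ₂.1 (X j) := by
    have h := rot n σ₁ ht₁ hs₁ ho₂ huni₁
    intro t ht
    rw [h t ht]
    exact (h 0 (by omega)).symm
  -- A detour would leave different colours on the cycle, hence none takes place.
  have fire : ∀ i < l, A (X i) (X l) → σ₂.1 (X i) ≠ σ₂.1 (X j) →
      ¬ IsOpen ((tour A n X l j)^[n] (tour A n X l i σ₂)) := by
    intro i hi hAi hne h
    have hij : i < j := lt_of_le_of_ne (hmax i hi hAi) fun h => hne (by rw [h])
    obtain ⟨h1, h2, h3, h4, -⟩ := tour_rotates hirr hX hl hi ht₂ hs₂ hAi h.of_iterate_tour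
    have h5 := uniform _ h2 h1 h (l - 1 - j) (by omega) (by omega)
    rw [show j + (l - 1 - j) = l - 1 by omega, h4, h3 j hij.le hj2] at h5
    exact hne (h5.trans (huni₂ 1 hj2))
  have none : ∀ k, IsOpen (detours A n X l j k σ₂) → detours A n X l j k σ₂ = σ₂ ∧
      ∀ i < k, i < l → A (X i) (X l) → σ₂.1 (X i) = σ₂.1 (X j) := by
    intro k
    induction k with
    | zero => intro _; exact ⟨rfl, fun i hi => absurd hi (by omega)⟩
    | succ k ih =>
      intro hk
      have hk' : IsOpen (detours A n X l j k σ₂) := by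
        by_contra h
        rw [detours, detour_of_not_isOpen h] at hk
        exact h hk
      obtain ⟨e, hlt⟩ := ih hk'
      rw [detours, e, detour] at hk ⊢
      split_ifs at hk ⊢ with hc
      · exact absurd hk (fire k hc.1 hc.2.1 hc.2.2)
      · refine ⟨rfl, fun i hi hil hAi => ?_⟩
        rcases Nat.lt_succ_iff_lt_or_eq.1 hi with hi | rfl
        · exact hlt i hi hil hAi
        · by_contra hne
          exact hc ⟨hil, hAi, hne⟩
  -- All in-neighbours of `X l` now have the same colour, but the token is stuck there.
  have hall := (none n ho').2
  have hmem : X j ∈ inNbrs A n (X l) := by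
    simp only [inNbrs, Finset.mem_filter, Finset.mem_range]
    exact ⟨hX.lt j hj.le, hA⟩
  have hpos : 0 < (inNbrs A n (X l)).card := Finset.card_pos.2 ⟨_, hmem⟩
  have hzero : ∀ c, c ≠ σ₂.1 (X j) → colourCount A n σ₂.1 c (X l) = 0 := by
    intro c hc
    rw [colourCount, Finset.card_eq_zero, Finset.filter_eq_empty_iff]
    intro y hy hyc
    simp only [inNbrs, Finset.mem_filter] at hy
    obtain ⟨r, hr, rfl⟩ := hX.maximal y hy.2
    exact hc (hyc.symm.trans (hall r (by omega) hr hy.2))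
  have e1 := hs₂.two_mul_colourCount (Or.inl rfl)
  have e2 := hs₂.two_mul_colourCount (Or.inr rfl)
  rw [ht₂] at e1 e2
  rcases eq_or_ne 1 (σ₂.1 (X j)) with h | h
  · have := hzero 2 (by omega)
    omega
  · have := hzero 1 h
    omega

end Tours

/-! ### Counting vertex by vertex -/

section Counting

variable {A : ℕ → ℕ → Prop}

theorem inNbrs_succ_of_adj {k v : ℕ} (h : A k v) :
    inNbrs A (k + 1) v = insert k (inNbrs A k v) := by
  rw [inNbrs, Finset.range_add_one, Finset.filter_insert, if_pos h, inNbrs]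

theorem inNbrs_succ_of_not_adj {k v : ℕ} (h : ¬ A k v) :
    inNbrs A (k + 1) v = inNbrs A k v := by
  rw [inNbrs, Finset.range_add_one, Finset.filter_insert, if_neg h, inNbrs]

theorem notMem_inNbrs (k v : ℕ) : k ∉ inNbrs A k v := by
  simp [inNbrs]

theorem colourCount_succ_of_adj {k v c : ℕ} {col : ℕ → ℕ} (h : A k v) :
    colourCount A (k + 1) col c v =
      colourCount A k col c v + if col k = c then 1 else 0 := by
  rw [colourCount, inNbrs_succ_of_adj h, Finset.filter_insert, colourCount]
  split_ifs
  · rw [Finset.card_insert_of_notMem]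
    exact fun h => notMem_inNbrs k v (Finset.mem_filter.1 h).1
  · rfl

theorem colourCount_succ_of_not_adj {k v c : ℕ} {col : ℕ → ℕ} (h : ¬ A k v) :
    colourCount A (k + 1) col c v = colourCount A k col c v := by
  rw [colourCount, inNbrs_succ_of_not_adj h, colourCount]

end Counting

/-! ### The token stays in the digraph -/

section TokenLt

variable {A : ℕ → ℕ → Prop} {n : ℕ}

theorem advance_snd_lt {x : ℕ} {σ : Config} (hx : x < n) (hσ : σ.2 < n) :
    (advance A n x σ).2 < n := by
  unfold advance
  split_ifs <;> assumption

theorem sweep_snd_lt {X : ℕ → ℕ} {l : ℕ} (hX : ∀ i ≤ l, X i < n) {σ : Config}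
    (hσ : σ.2 < n) (i k : ℕ) : (sweep A n X l i k σ).2 < n := by
  induction k with
  | zero => exact hσ
  | succ k ih =>
    rw [sweep]
    split_ifs with h
    · exact advance_snd_lt (hX k h.2) ih
    · exact ih

theorem tour_snd_lt {X : ℕ → ℕ} {l : ℕ} (hX : ∀ i ≤ l, X i < n) {σ : Config}
    (hσ : σ.2 < n) (i : ℕ) : (tour A n X l i σ).2 < n :=
  advance_snd_lt (hX l le_rfl) (sweep_snd_lt hX hσ i n)

theorem iterate_tour_snd_lt {X : ℕ → ℕ} {l : ℕ} (hX : ∀ i ≤ l, X i < n) {σ : Config}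
    (hσ : σ.2 < n) (i m : ℕ) : ((tour A n X l i)^[m] σ).2 < n := by
  induction m with
  | zero => exact hσ
  | succ m ih =>
    rw [Function.iterate_succ_apply']
    exact tour_snd_lt hX ih i

theorem detours_snd_lt {X : ℕ → ℕ} {l : ℕ} (hX : ∀ i ≤ l, X i < n) {σ : Config}
    (hσ : σ.2 < n) (j k : ℕ) : (detours A n X l j k σ).2 < n := by
  induction k with
  | zero => exact hσ
  | succ k ih =>
    rw [detours, detour]
    split_ifs
    · exact iterate_tour_snd_lt hX (tour_snd_lt hX ih k) j n
    · exact ih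

end TokenLt

/-! ### Degenerate colour classes -/

/-- The colour class `c` is degenerate: every nonempty set of vertices of colour `c` has a member
fewer than half of whose in-neighbours lie in the set. -/
def IsDegenerate (A : ℕ → ℕ → Prop) (n : ℕ) (col : ℕ → ℕ) (c : ℕ) : Prop :=
  ∀ W : Finset ℕ, W.Nonempty → (∀ v ∈ W, v < n ∧ col v = c) →
    ∃ v ∈ W, 2 * ((inNbrs A n v).filter fun u => u ∈ W).card < (inNbrs A n v).card

/-- The invariant of the treatment of the vertex `u`: both colour classes are degenerate, and no
vertex up to `u`, except possibly the one with the token, is uncoloured. -/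
structure IsValid (A : ℕ → ℕ → Prop) (n u : ℕ) (σ : Config) : Prop where
  lt : σ.2 < n
  degenerate : ∀ c, c = 1 ∨ c = 2 → IsDegenerate A n σ.1 c
  le : ∀ v < n, σ.1 v ≤ 2
  coloured : ∀ v < u + 1, σ.1 v = 0 → v = σ.2

variable {A : ℕ → ℕ → Prop} {n : ℕ}

/-- A class stays degenerate when it gains a vertex fewer than half of whose in-neighbours belong
to it. -/
theorem IsDegenerate.of_insert {col col' : ℕ → ℕ} {c z : ℕ} (h : IsDegenerate A n col c)
    (hsub : ∀ v, v ≠ z → col' v = c → col v = c)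
    (hz : 2 * ((inNbrs A n z).filter fun u => col' u = c).card < (inNbrs A n z).card) :
    IsDegenerate A n col' c := by
  intro W hW hWc
  by_cases hzW : z ∈ W
  · refine ⟨z, hzW, lt_of_le_of_lt (Nat.mul_le_mul_left 2 (Finset.card_le_card ?_)) hz⟩
    intro u hu
    simp only [Finset.mem_filter] at hu ⊢
    exact ⟨hu.1, (hWc u hu.2).2⟩
  · refine h W hW fun v hv => ⟨(hWc v hv).1, hsub v ?_ (hWc v hv).2⟩
    rintro rfl
    exact hzW hv

theorem colourCount_update_self (hirr : ∀ v, ¬ A v v) (col : ℕ → ℕ) (z a c : ℕ) :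
    ((inNbrs A n z).filter fun u => Function.update col z a u = c).card =
      colourCount A n col c z := by
  unfold colourCount
  congr 1
  refine Finset.filter_congr fun u hu => ?_
  simp only [inNbrs, Finset.mem_filter] at hu
  rw [Function.update_of_ne]
  rintro rfl
  exact hirr _ hu.2

theorem IsDegenerate.update (hirr : ∀ v, ¬ A v v) {col : ℕ → ℕ} {c z a : ℕ}
    (h : IsDegenerate A n col c)
    (ha : a = c → 2 * colourCount A n col c z < (inNbrs A n z).card) :
    IsDegenerate A n (Function.update col z a) c := by
  by_cases hac : a = c
  · refine h.of_insert (z := z) (fun v hv => ?_) ?_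
    · rw [Function.update_of_ne hv]; exact id
    · rw [colourCount_update_self hirr]
      exact ha hac
  · intro W hW hWc
    refine h W hW fun v hv => ⟨(hWc v hv).1, ?_⟩
    have := (hWc v hv).2
    rcases eq_or_ne v z with rfl | hvz
    · rw [Function.update_self] at this
      exact absurd this hac
    · rwa [Function.update_of_ne hvz] at this

/-- The invariant is kept by every step. When the token moves from `z` to `x`, the vertex `z`
enters the class that `x` leaves, and as exactly half of the in-neighbours of `z` belonged to that
class, now fewer than half do. -/
theorem IsValid.advance (hirr : ∀ v, ¬ A v v) (hlt : ∀ u v, A u v → u < n) {u x : ℕ} {σ : Config}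
    (h : IsValid A n u σ) : IsValid A n u (advance A n x σ) := by
  have place : ∀ c, (c = 1 ∨ c = 2) → 2 * colourCount A n σ.1 c σ.2 < (inNbrs A n σ.2).card →
      IsValid A n u (Function.update σ.1 σ.2 c, σ.2) := by
    intro c hc hcount
    refine ⟨h.lt, fun c' hc' => (h.degenerate c' hc').update hirr ?_, fun v hv => ?_,
      fun v hv hv0 => ?_⟩
    · rintro rfl
      exact hcount
    · rcases eq_or_ne v σ.2 with rfl | hne
      · simp only [Function.update_self]; omega
      · simp only [Function.update_of_ne hne]; exact h.le v hv
    · by_contra hne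
      simp only [Function.update_of_ne hne] at hv0
      exact hne (h.coloured v hv hv0)
  by_cases hopen : σ.1 σ.2 = 0
  swap
  · rwa [advance_of_not_isOpen hopen]
  by_cases h1 : 2 * colourCount A n σ.1 1 σ.2 < (inNbrs A n σ.2).card
  · rw [DynMon.advance, if_pos hopen, if_pos h1]
    exact place 1 (Or.inl rfl) h1
  by_cases h2 : 2 * colourCount A n σ.1 2 σ.2 < (inNbrs A n σ.2).card
  · rw [DynMon.advance, if_pos hopen, if_neg h1, if_pos h2]
    exact place 2 (Or.inr rfl) h2
  have hs : IsStuck A n σ := ⟨hopen, not_lt.1 h1, not_lt.1 h2⟩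
  by_cases hx : A x σ.2
  swap
  · rwa [hs.advance_eq_self hx]
  rw [hs.advance_eq hx]
  have hxn : x ∈ inNbrs A n σ.2 := by
    simp only [inNbrs, Finset.mem_filter, Finset.mem_range]
    exact ⟨hlt _ _ hx, hx⟩
  have hcx := hs.colour hxn
  refine ⟨hlt _ _ hx, fun c hc => ?_, fun v hv => ?_, fun v hv hv0 => ?_⟩
  · by_cases hcol : σ.1 x = c
    swap
    · exact ((h.degenerate c hc).update hirr fun e => absurd e hcol).update hirr fun e => by omega
    refine (h.degenerate c hc).of_insert (z := σ.2) (fun v hv hvc => ?_) ?_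
    · rcases eq_or_ne v x with rfl | hvx
      · exact hcol
      · simpa only [Function.update_of_ne hvx, Function.update_of_ne hv] using hvc
    · have hhalf := hs.two_mul_colourCount hc
      refine lt_of_lt_of_eq (Nat.mul_lt_mul_of_pos_left (Finset.card_lt_card
        ⟨fun w hw => ?_, fun hsub => ?_⟩) two_pos) hhalf
      · simp only [Finset.mem_filter] at hw ⊢
        refine ⟨hw.1, ?_⟩
        have hwz : w ≠ σ.2 := by
          rintro rfl
          have := hw.1
          simp only [inNbrs, Finset.mem_filter] at this
          exact hirr _ this.2
        rcases eq_or_ne w x with rfl | hwx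
        · exact hcol
        · simpa only [Function.update_of_ne hwx, Function.update_of_ne hwz] using hw.2
      · have := hsub (Finset.mem_filter.2 ⟨hxn, hcol⟩)
        simp only [Finset.mem_filter, Function.update_self] at this
        omega
  · rcases eq_or_ne v x with rfl | hvx
    · simp
    · simp only [Function.update_of_ne hvx]
      rcases eq_or_ne v σ.2 with rfl | hvz
      · rw [Function.update_self]; omega
      · rw [Function.update_of_ne hvz]; exact h.le v hv
  · by_contra hvx
    simp only [Function.update_of_ne hvx] at hv0
    rcases eq_or_ne v σ.2 with rfl | hvz
    · rw [Function.update_self] at hv0; omega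
    · rw [Function.update_of_ne hvz] at hv0
      exact hvz (h.coloured v hv hv0)

/-! ### The invariant of the algorithm -/

section Invariant

variable {u l j : ℕ} {X : ℕ → ℕ} {σ : Config}

theorem IsValid.sweep (hirr : ∀ v, ¬ A v v) (hlt : ∀ u v, A u v → u < n) (h : IsValid A n u σ)
    (i k : ℕ) : IsValid A n u (sweep A n X l i k σ) := by
  induction k with
  | zero => exact h
  | succ k ih =>
    rw [DynMon.sweep]
    split_ifs
    · exact ih.advance hirr hlt
    · exact ih

theorem IsValid.tour (hirr : ∀ v, ¬ A v v) (hlt : ∀ u v, A u v → u < n) (h : IsValid A n u σ)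
    (i : ℕ) : IsValid A n u (tour A n X l i σ) :=
  (h.sweep hirr hlt i n).advance hirr hlt

theorem IsValid.iterate_tour (hirr : ∀ v, ¬ A v v) (hlt : ∀ u v, A u v → u < n)
    (h : IsValid A n u σ) (i m : ℕ) : IsValid A n u ((DynMon.tour A n X l i)^[m] σ) := by
  induction m with
  | zero => exact h
  | succ m ih =>
    rw [Function.iterate_succ_apply']
    exact ih.tour hirr hlt i

theorem IsValid.detours (hirr : ∀ v, ¬ A v v) (hlt : ∀ u v, A u v → u < n) (h : IsValid A n u σ)
    (k : ℕ) : IsValid A n u (detours A n X l j k σ) := by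
  induction k with
  | zero => exact h
  | succ k ih =>
    rw [DynMon.detours, detour]
    split_ifs
    · exact (ih.tour hirr hlt k).iterate_tour hirr hlt j n
    · exact ih

theorem IsValid.settle (hirr : ∀ v, ¬ A v v) (hlt : ∀ u v, A u v → u < n) (h : IsValid A n u σ) :
    IsValid A n u (settle A n X l j σ) :=
  ((h.tour hirr hlt 0).iterate_tour hirr hlt j n).detours hirr hlt n

end Invariant

/-! ### From degenerate classes to dynamic monopolies -/

/-- A strict majority of the in-neighbours, in terms of natural numbers. -/
theorem strictMajority_le_iff {V : Type*} [Fintype V] (G : Digraph V) (v : V) (m : ℕ) :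
    strictMajority G v ≤ m ↔ inDegree G v < 2 * m := by
  rw [strictMajority, Nat.ceil_le, div_le_iff₀ (by norm_num : (0 : ℚ) < 2)]
  constructor
  · intro h
    have : inDegree G v + 1 ≤ m * 2 := by exact_mod_cast h
    omega
  · intro h
    have : inDegree G v + 1 ≤ m * 2 := by omega
    exact_mod_cast this

open Classical in
/-- If every proper superset `S` of `M` sends enough edges to some vertex outside of `S`, then `M` is
a dynamic monopoly. -/
theorem isDynamicMonopoly_of_exists_le {V : Type*} [Fintype V] (G : Digraph V) (τ : V → ℕ)
    (M : Finset V)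
    (h : ∀ S : Finset V, M ⊆ S → S ≠ Finset.univ → ∃ v ∉ S, τ v ≤ edgesFrom G S v) :
    IsDynamicMonopoly G τ M := by
  -- `B i` is the set of the vertices that are active after `i` rounds.
  let B : ℕ → Finset V := fun i => Nat.rec M
    (fun _ S => S ∪ Finset.univ.filter fun v => τ v ≤ edgesFrom G S v) i
  have hBs : ∀ i, B (i + 1) = B i ∪ Finset.univ.filter fun v => τ v ≤ edgesFrom G (B i) v :=
    fun i => rfl
  have hmono : Monotone B := monotone_nat_of_le_succ fun i => by
    rw [hBs]; exact Finset.subset_union_left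
  have hcard : ∀ i, i ≤ (B i).card ∨ B i = Finset.univ := by
    intro i
    induction i with
    | zero => exact Or.inl (Nat.zero_le _)
    | succ i ih =>
      rcases eq_or_ne (B i) Finset.univ with hi | hi
      · exact Or.inr (Finset.univ_subset_iff.1 (hi ▸ hmono (Nat.le_succ i)))
      · left
        obtain ⟨v, hv, hle⟩ := h _ (hmono (Nat.zero_le i)) hi
        have : (B i).card < (B (i + 1)).card := by
          refine Finset.card_lt_card ⟨hmono (Nat.le_succ i), fun hsub => ?_⟩
          refine hv (hsub ?_)
          rw [hBs]
          simp [hle]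
        have := ih.resolve_right hi
        omega
  have hfull : B (Fintype.card V) = Finset.univ := by
    rcases hcard (Fintype.card V) with hc | hc
    · exact Finset.eq_univ_of_card _ (le_antisymm (Finset.card_le_univ _) hc)
    · exact hc
  let D : ℕ → Finset V := fun i => Nat.casesOn i M fun i => B (i + 1) \ B i
  have hDB : ∀ i, D i ⊆ B i := by
    rintro (_ | i)
    · exact subset_rfl
    · exact Finset.sdiff_subset
  have hdisj : ∀ i j, i < j → Disjoint (D i) (D j) := by
    rintro i (_ | j) hij
    · omega
    · exact (Finset.disjoint_sdiff).mono_left ((hDB i).trans (hmono (by omega)))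
  have hunion : ∀ i, (Finset.range (i + 1)).biUnion D = B i := by
    intro i
    induction i with
    | zero => simp [D, B]
    | succ i ih =>
      rw [Finset.range_add_one, Finset.biUnion_insert, ih]
      exact Finset.sdiff_union_of_subset (hmono (Nat.le_succ i))
  refine ⟨Fintype.card V, D, fun i _ j _ hij => ?_, fun v => ?_, rfl, ?_⟩
  · rcases hij.lt_or_gt with hij | hij
    · exact hdisj i j hij
    · exact (hdisj j i hij).symm
  · have : v ∈ (Finset.range (Fintype.card V + 1)).biUnion D := by
      rw [hunion, hfull]; exact Finset.mem_univ v
    obtain ⟨i, hi, hv⟩ := Finset.mem_biUnion.1 this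
    exact ⟨i, Nat.lt_succ_iff.1 (Finset.mem_range.1 hi), hv⟩
  · rintro (_ | i) hi _ v hv
    · omega
    · rw [hunion]
      have hv' := Finset.mem_sdiff.1 hv
      have := hv'.1
      rw [hBs] at this
      simpa [hv'.2] using this

/-- The relation on `ℕ` that a digraph on `Fin n` induces. -/
def natAdj {n : ℕ} (G : Digraph (Fin n)) (x y : ℕ) : Prop :=
  ∃ (hx : x < n) (hy : y < n), G.Adj ⟨x, hx⟩ ⟨y, hy⟩

theorem map_filter_adj {n : ℕ} (G : Digraph (Fin n)) (p : ℕ → Prop) [DecidablePred p]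
    [DecidableRel G.Adj] (v : Fin n) :
    (((Finset.univ : Finset (Fin n)).filter fun u => G.Adj u v ∧ p u).map
      Fin.valEmbedding) = (inNbrs (natAdj G) n v).filter p := by
  ext x
  simp only [inNbrs, Finset.mem_map, Finset.mem_filter, Finset.mem_univ, true_and,
    Finset.mem_range, Fin.valEmbedding_apply]
  constructor
  · rintro ⟨u, ⟨h1, h2⟩, rfl⟩
    exact ⟨⟨u.2, u.2, v.2, h1⟩, h2⟩
  · rintro ⟨⟨hx, _, _, h1⟩, h2⟩
    exact ⟨⟨x, hx⟩, ⟨h1, h2⟩, rfl⟩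

theorem inDegree_eq_card {n : ℕ} (G : Digraph (Fin n)) (v : Fin n) :
    inDegree G v = (inNbrs (natAdj G) n v).card := by
  classical
  have := map_filter_adj G (fun _ => True) v
  rw [Finset.filter_true] at this
  rw [← this, Finset.card_map, inDegree, edgesFrom]
  congr 1
  ext
  simp

/-- A set whose complement is a degenerate class is a strict majority dynamic monopoly. -/
theorem isStrictMajorityDynamo_of_isDegenerate {n : ℕ} (G : Digraph (Fin n)) {col : ℕ → ℕ} {c : ℕ}
    (h : IsDegenerate (natAdj G) n col c) (M : Finset (Fin n))
    (hM : ∀ v : Fin n, v ∉ M → col v = c) : IsStrictMajorityDynamo G M := by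
  classical
  refine isDynamicMonopoly_of_exists_le G _ M fun S hMS hS => ?_
  obtain ⟨x, hx, hlt⟩ := h (Sᶜ.map Fin.valEmbedding) (by
    rw [Finset.map_nonempty, Finset.nonempty_iff_ne_empty]
    simpa using hS) (by
    intro x hx
    obtain ⟨v, hv, rfl⟩ := Finset.mem_map.1 hx
    exact ⟨v.2, hM v fun hvM => Finset.mem_compl.1 hv (hMS hvM)⟩)
  obtain ⟨v, hv, rfl⟩ := Finset.mem_map.1 hx
  refine ⟨v, Finset.mem_compl.1 hv, ?_⟩
  rw [strictMajority_le_iff]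
  have h1 := inDegree_eq_card G v
  have h2 := congrArg Finset.card (map_filter_adj G (fun u => u ∈ Sᶜ.map Fin.valEmbedding) v)
  rw [Finset.card_map] at h2
  have h3 : inDegree G v = edgesFrom G S v +
      (Finset.univ.filter fun u : Fin n => G.Adj u v ∧ (u : ℕ) ∈ Sᶜ.map Fin.valEmbedding).card := by
    rw [inDegree, edgesFrom, edgesFrom, ← Finset.card_union_of_disjoint]
    · congr 1
      ext u
      simp only [Finset.mem_filter, Finset.mem_univ, true_and, Finset.mem_union]
      have : (u : ℕ) ∈ Sᶜ.map Fin.valEmbedding ↔ u ∉ S := by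
        simp [Fin.val_inj]
      tauto
    · rw [Finset.disjoint_left]
      intro u hu hu'
      simp only [Finset.mem_filter] at hu hu'
      have : u ∉ S := by simpa [Fin.val_inj] using hu'.2.2
      exact this hu.1
  have h4 : 2 * (Finset.univ.filter fun u : Fin n =>
      G.Adj u v ∧ (u : ℕ) ∈ Sᶜ.map Fin.valEmbedding).card < (inNbrs (natAdj G) n v).card := by
    rw [h2]
    convert hlt <;> rfl
  omega

end DynMon

namespace RAM

/-! ### Programs with bounded loops only -/

/-- Programs all of whose loops are of the form `for i = 0, …, n - 1`, where `n` is the content of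
cell `0` of array `0`, and the counter `i` is kept in cell `0` of an array of its own. -/
inductive ForProg : Type
  | skip
  | assign (a : ℕ) (i e : Expr)
  | seq (c₁ c₂ : ForProg)
  | ite (e : Expr) (c₁ c₂ : ForProg)
  | loop (i : ℕ) (c : ForProg)

namespace ForProg

/-- The translation into programs for the random access machine. -/
def toProg : ForProg → Prog
  | skip => .skip
  | assign a i e => .assign a i e
  | seq c₁ c₂ => .seq c₁.toProg c₂.toProg
  | ite e c₁ c₂ => .ite e c₁.toProg c₂.toProg
  | loop i c =>
    .seq (.assign i (.const 0) (.const 0))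
      (.loop (.sub (.read 0 (.const 0)) (.read i (.const 0)))
        (.seq c.toProg (.assign i (.const 0) (.add (.read i (.const 0)) (.const 1)))))

/-- The arrays that a program writes to. -/
def writes : ForProg → List ℕ
  | skip => []
  | assign a _ _ => [a]
  | seq c₁ c₂ => c₁.writes ++ c₂.writes
  | ite _ c₁ c₂ => c₁.writes ++ c₂.writes
  | loop i c => i :: c.writes

/-- No loop changes its own counter, nor the array `0`, which holds the loop bound. -/
def IsWellFormed : ForProg → Prop
  | skip => True
  | assign a _ _ => a ≠ 0
  | seq c₁ c₂ => c₁.IsWellFormed ∧ c₂.IsWellFormed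
  | ite _ c₁ c₂ => c₁.IsWellFormed ∧ c₂.IsWellFormed
  | loop i c => i ≠ 0 ∧ i ∉ c.writes ∧ c.IsWellFormed

instance decidableIsWellFormed : (c : ForProg) → Decidable c.IsWellFormed
  | skip => instDecidableTrue
  | assign a _ _ => inferInstanceAs (Decidable (a ≠ 0))
  | seq c₁ c₂ => @instDecidableAnd _ _ (decidableIsWellFormed c₁) (decidableIsWellFormed c₂)
  | ite _ c₁ c₂ => @instDecidableAnd _ _ (decidableIsWellFormed c₁) (decidableIsWellFormed c₂)
  | loop _ c =>
    @instDecidableAnd _ _ inferInstance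
      (@instDecidableAnd _ _ inferInstance (decidableIsWellFormed c))

/-- The final store of a program, as a function of the initial store. -/
def run : ForProg → Store → Store
  | skip, s => s
  | assign a i e, s => s.write a (i.eval s) (e.eval s)
  | seq c₁ c₂, s => c₂.run (c₁.run s)
  | ite e c₁ c₂, s => if e.eval s ≠ 0 then c₁.run s else c₂.run s
  | loop i c, s => Nat.rec (s.write i 0 0) (fun k s' => (c.run s').write i 0 (k + 1)) (s 0 0)

/-- A bound for the number of steps, as a polynomial in the loop bound `n`. -/
noncomputable def time : ForProg → Polynomial ℕ
  | skip => 1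
  | assign _ i e => (i.cost + e.cost + 1 : ℕ)
  | seq c₁ c₂ => c₁.time + c₂.time
  | ite e c₁ c₂ => (e.cost + 1 : ℕ) + (c₁.time + c₂.time)
  | loop _ c => Polynomial.X * (c.time + 12) + 9

theorem run_seq (c₁ c₂ : ForProg) (s : Store) : (seq c₁ c₂).run s = c₂.run (c₁.run s) := rfl

theorem run_ite (e : Expr) (c₁ c₂ : ForProg) (s : Store) :
    (ite e c₁ c₂).run s = if e.eval s ≠ 0 then c₁.run s else c₂.run s := rfl

end ForProg

theorem Store.write_self (s : Store) (a i x : ℕ) : s.write a i x a = Function.update (s a) i x := by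
  funext j
  by_cases h : j = i
  · subst h; simp [Store.write]
  · simp [Store.write, h]

theorem Store.write_of_ne (s : Store) {a b : ℕ} (h : b ≠ a) (i x : ℕ) : s.write a i x b = s b := by
  funext j
  simp [Store.write, h]

namespace ForProg

theorem run_of_notMem_writes {c : ForProg} {a : ℕ} (h : a ∉ c.writes) (s : Store) :
    c.run s a = s a := by
  induction c generalizing s with
  | skip => rfl
  | assign b i e =>
    simp only [writes, List.mem_singleton] at h
    exact s.write_of_ne h _ _
  | seq c₁ c₂ h₁ h₂ =>
    simp only [writes, List.mem_append, not_or] at h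
    rw [run_seq, h₂ h.2, h₁ h.1]
  | ite e c₁ c₂ h₁ h₂ =>
    simp only [writes, List.mem_append, not_or] at h
    rw [run_ite]
    split_ifs
    · exact h₁ h.1 s
    · exact h₂ h.2 s
  | loop i c ih =>
    simp only [writes, List.mem_cons, not_or] at h
    rw [run]
    induction s 0 0 with
    | zero => exact s.write_of_ne h.1 _ _
    | succ k hk => exact (Store.write_of_ne _ h.1 _ _).trans ((ih h.2 _).trans hk)

/-- The induction principle for loops. -/
theorem run_loop {i : ℕ} {c : ForProg} {s : Store} {n : ℕ} (hn : s 0 0 = n)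
    (Q : ℕ → Store → Prop) (h₀ : Q 0 (s.write i 0 0))
    (hs : ∀ k < n, ∀ s' : Store, s' i 0 = k → (∀ a, a ∉ (loop i c).writes → s' a = s a) → Q k s' →
      Q (k + 1) ((c.run s').write i 0 (k + 1))) :
    Q n ((loop i c).run s) := by
  rw [run, hn]
  let S : ℕ → Store := fun k =>
    Nat.rec (s.write i 0 0) (fun k s' => (c.run s').write i 0 (k + 1)) k
  suffices h : ∀ k ≤ n, S k i 0 = k ∧ (∀ a, a ∉ (loop i c).writes → S k a = s a) ∧ Q k (S k) from
    (h n le_rfl).2.2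
  intro k
  induction k with
  | zero =>
    intro _
    refine ⟨by simp [S, Store.write], fun a ha => ?_, h₀⟩
    simp only [writes, List.mem_cons, not_or] at ha
    exact s.write_of_ne ha.1 _ _
  | succ k ih =>
    intro hk
    obtain ⟨h1, h2, h3⟩ := ih (by omega)
    refine ⟨by simp [S, Store.write], fun a ha => ?_, hs k (by omega) _ h1 h2 h3⟩
    rw [← h2 a ha]
    simp only [writes, List.mem_cons, not_or] at ha
    exact (Store.write_of_ne _ ha.1 _ _).trans (run_of_notMem_writes ha.2 _)

theorem IsWellFormed.zero_notMem_writes {c : ForProg} (h : c.IsWellFormed) : 0 ∉ c.writes := by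
  induction c with
  | skip => simp [writes]
  | assign a i e => simpa [writes] using Ne.symm h
  | seq c₁ c₂ h₁ h₂ => simp [writes, h₁ h.1, h₂ h.2]
  | ite e c₁ c₂ h₁ h₂ => simp [writes, h₁ h.1, h₂ h.2]
  | loop i c ih => simp [writes, ih h.2.2, Ne.symm h.1]

/-- A well-formed program halts in polynomial time. -/
theorem IsWellFormed.exec {c : ForProg} (h : c.IsWellFormed) (s : Store) :
    ∃ t ≤ c.time.eval (s 0 0), Exec c.toProg s (c.run s) t := by
  induction c generalizing s with
  | skip => exact ⟨1, by simp [time], .skip s⟩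
  | assign a i e => exact ⟨_, by simp [time], .assign a i e s⟩
  | seq c₁ c₂ h₁ h₂ =>
    obtain ⟨t₁, ht₁, e₁⟩ := h₁ h.1 s
    obtain ⟨t₂, ht₂, e₂⟩ := h₂ h.2 (c₁.run s)
    rw [run_of_notMem_writes h.1.zero_notMem_writes] at ht₂
    exact ⟨t₁ + t₂, by simp only [time, Polynomial.eval_add]; omega, .seq e₁ e₂⟩
  | ite e c₁ c₂ h₁ h₂ =>
    rw [run_ite]
    split_ifs with he
    · obtain ⟨t, ht, ex⟩ := h₁ h.1 s
      refine ⟨_, ?_, .ite_true he ex⟩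
      simp only [time, Polynomial.eval_add, Polynomial.eval_natCast, Nat.cast_id]
      omega
    · obtain ⟨t, ht, ex⟩ := h₂ h.2 s
      refine ⟨_, ?_, .ite_false (not_not.1 he) ex⟩
      simp only [time, Polynomial.eval_add, Polynomial.eval_natCast, Nat.cast_id]
      omega
  | loop i c ih =>
    obtain ⟨hi0, hi, hc⟩ := h
    have h0 : 0 ∉ (loop i c).writes := IsWellFormed.zero_notMem_writes (c := loop i c) ⟨hi0, hi, hc⟩
    set n := s 0 0 with hn
    let S : ℕ → Store := fun k =>
      Nat.rec (s.write i 0 0) (fun k s' => (c.run s').write i 0 (k + 1)) k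
    have hS0 : ∀ k, S k 0 0 = n := by
      intro k
      induction k with
      | zero => exact congrFun (s.write_of_ne hi0.symm _ _) 0
      | succ k hk =>
        exact (congrFun (Store.write_of_ne _ hi0.symm _ _) 0).trans
          ((congrFun (run_of_notMem_writes hc.zero_notMem_writes _) 0).trans hk)
    have hSi : ∀ k, S k i 0 = k := by
      rintro (_ | k) <;> simp [S, Store.write]
    let e : Expr := .sub (.read 0 (.const 0)) (.read i (.const 0))
    let b : Prog :=
      .seq c.toProg (.assign i (.const 0) (.add (.read i (.const 0)) (.const 1)))
    have he : ∀ k, e.eval (S k) = n - k := fun k => by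
      simp only [e, Expr.eval, hS0, hSi]
    -- The last `m` rounds of the loop.
    have key : ∀ m ≤ n, ∃ t ≤ m * (c.time.eval n + 12) + 6,
        Exec (.loop e b) (S (n - m)) (S n) t := by
      intro m
      induction m with
      | zero =>
        intro _
        exact ⟨6, by omega, .loop_false (by rw [he]; omega)⟩
      | succ m hm =>
        intro hmn
        obtain ⟨t, ht, ex⟩ := hm (by omega)
        obtain ⟨t', ht', ex'⟩ := ih hc (S (n - (m + 1)))
        rw [hS0] at ht'
        have hstep : Exec b (S (n - (m + 1))) (S (n - m)) (t' + 6) := by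
          have ha := Exec.assign i (.const 0) (.add (.read i (.const 0)) (.const 1))
            (c.run (S (n - (m + 1))))
          have hval : (Expr.add (.read i (.const 0)) (.const 1)).eval (c.run (S (n - (m + 1)))) =
              n - (m + 1) + 1 := by
            simp only [Expr.eval]
            rw [run_of_notMem_writes hi, hSi]
          rw [hval] at ha
          have hSm : S (n - m) = (c.run (S (n - (m + 1)))).write i 0 (n - (m + 1) + 1) := by
            rw [show n - m = n - (m + 1) + 1 by omega]
          rw [hSm]
          exact .seq ex' ha
        refine ⟨_, ?_, .loop_true (by rw [he]; omega) hstep ex⟩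
        have hcost : e.cost = 5 := rfl
        rw [hcost, Nat.succ_mul]
        omega
    obtain ⟨t, ht, ex⟩ := key n le_rfl
    rw [Nat.sub_self] at ex
    have hrun : (loop i c).run s = S n := rfl
    rw [hrun]
    refine ⟨3 + t, ?_, .seq (.assign i (.const 0) (.const 0) s) ex⟩
    simp only [time, Polynomial.eval_add, Polynomial.eval_mul, Polynomial.eval_X,
      Polynomial.eval_ofNat]
    omega

end ForProg

/-! ### The algorithm -/

/- The names of the arrays. Those that begin with `i` hold loop counters. Except for the adjacency
matrix, the output, the colours, the path, the marks and the row offsets, only the cell `0` of an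
array is used. -/

local notation "aSize" => (0 : ℕ)
local notation "aAdj" => (1 : ℕ)
local notation "aOutput" => (2 : ℕ)
local notation "aColour" => (3 : ℕ)
local notation "aToken" => (4 : ℕ)
local notation "aPath" => (5 : ℕ)
local notation "aVisited" => (6 : ℕ)
local notation "aLength" => (7 : ℕ)
local notation "aEntry" => (8 : ℕ)
local notation "aStart" => (9 : ℕ)
local notation "aRow" => (10 : ℕ)
local notation "aTarget" => (11 : ℕ)
local notation "aCountOne" => (12 : ℕ)
local notation "aCountTwo" => (13 : ℕ)
local notation "aDegree" => (14 : ℕ)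
local notation "iNbr" => (15 : ℕ)
local notation "iSweep" => (16 : ℕ)
local notation "iTour" => (17 : ℕ)
local notation "iDetour" => (18 : ℕ)
local notation "iVertex" => (19 : ℕ)
local notation "iRound" => (20 : ℕ)
local notation "iNext" => (21 : ℕ)
local notation "iEntry" => (22 : ℕ)
local notation "iRow" => (23 : ℕ)
local notation "aCount" => (24 : ℕ)
local notation "iCount" => (25 : ℕ)
local notation "iOutput" => (26 : ℕ)

namespace Expr

/-- The variable kept in cell `0` of the array `a`. -/
def var (a : ℕ) : Expr := .read a (.const 0)

/-- The entry `(x, y)` of the adjacency matrix, found by means of the table of the row offsets. -/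
def edge (x y : Expr) : Expr := .read aAdj (.add (.read aRow x) y)

/-- The test `x < y`. -/
def lt (x y : Expr) : Expr := .sub y x

/-- The test `x = y`. -/
def eq (x y : Expr) : Expr := .sub (.const 1) (.add (.sub x y) (.sub y x))

/-- The successor of `x`. -/
def succ (x : Expr) : Expr := .add x (.const 1)

variable (x y : Expr) (s : Store)

@[simp] theorem eval_const (c : ℕ) : (Expr.const c).eval s = c := rfl
@[simp] theorem eval_read (a : ℕ) : (Expr.read a x).eval s = s a (x.eval s) := rfl
@[simp] theorem eval_add : (Expr.add x y).eval s = x.eval s + y.eval s := rfl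
@[simp] theorem eval_sub : (Expr.sub x y).eval s = x.eval s - y.eval s := rfl
@[simp] theorem eval_var (a : ℕ) : (var a).eval s = s a 0 := rfl
@[simp] theorem eval_succ : (succ x).eval s = x.eval s + 1 := rfl
@[simp] theorem eval_edge : (edge x y).eval s = s aAdj (s aRow (x.eval s) + y.eval s) := rfl

@[simp] theorem eval_lt_ne_zero : (lt x y).eval s ≠ 0 ↔ x.eval s < y.eval s := by
  simp only [lt, eval_sub]; omega

@[simp] theorem eval_eq_ne_zero : (eq x y).eval s ≠ 0 ↔ x.eval s = y.eval s := by
  simp only [eq, eval_sub, eval_add, eval_const]; omega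

end Expr

namespace ForProg

open RAM.Expr

/-- The assignment to the variable kept in cell `0` of the array `a`. -/
def set (a : ℕ) (e : Expr) : ForProg := assign a (.const 0) e

/-- The conditional without alternative. -/
def when (e : Expr) (c : ForProg) : ForProg := ite e c skip

/-- Count the in-neighbours of the vertex with the token, and those of either colour. -/
def countNbrs : ForProg :=
  seq (set aDegree (.const 0)) <| seq (set aCountOne (.const 0)) <|
  seq (set aCountTwo (.const 0)) <|
  loop iNbr <| when (edge (var iNbr) (var aToken)) <|
    seq (set aDegree (succ (var aDegree))) <|
    seq (when (eq (.read aColour (var iNbr)) (.const 1)) (set aCountOne (succ (var aCountOne)))) <|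
    when (eq (.read aColour (var iNbr)) (.const 2)) (set aCountTwo (succ (var aCountTwo)))

/-- `DynMon.advance`, with the vertex in `aTarget`. -/
def advance : ForProg :=
  when (eq (.read aColour (var aToken)) (.const 0)) <|
  seq countNbrs <|
  ite (lt (.add (var aCountOne) (var aCountOne)) (var aDegree))
    (assign aColour (var aToken) (.const 1)) <|
  ite (lt (.add (var aCountTwo) (var aCountTwo)) (var aDegree))
    (assign aColour (var aToken) (.const 2)) <|
  when (edge (var aTarget) (var aToken)) <|
    seq (assign aColour (var aToken) (.read aColour (var aTarget))) <|
    seq (assign aColour (var aTarget) (.const 0)) <|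
    set aToken (var aTarget)

/-- `DynMon.tour`, with the first index in `aStart`. -/
def tour : ForProg :=
  seq
    (loop iSweep <| when (lt (var aStart) (succ (var iSweep))) <|
      when (lt (var iSweep) (succ (var aLength))) <|
      seq (set aTarget (.read aPath (var iSweep))) advance) <|
  seq (set aTarget (.read aPath (var aLength))) advance

/-- Tours from the index in `aEntry`, as many as there are vertices. -/
def tours : ForProg := loop iTour <| seq (set aStart (var aEntry)) tour

/-- `DynMon.detour`, with the index of the in-neighbour in `iDetour`. -/
def detour : ForProg :=
  when (lt (var iDetour) (var aLength)) <|
  when (edge (.read aPath (var iDetour)) (.read aPath (var aLength))) <|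
  ite (eq (.read aColour (.read aPath (var iDetour))) (.read aColour (.read aPath (var aEntry))))
    skip <|
  seq (set aStart (var iDetour)) <| seq tour tours

/-- `DynMon.settle`. -/
def settle : ForProg :=
  seq (set aStart (.const 0)) <| seq tour <| seq tours <| loop iDetour detour

/-- Build a maximal path greedily, starting at the vertex in `iVertex`. The vertices on the path
are marked with a number that depends on this vertex, so that old marks need not be deleted. -/
def buildPath : ForProg :=
  seq (assign aPath (.const 0) (var iVertex)) <|
  seq (set aLength (.const 0)) <|
  seq (assign aVisited (var iVertex) (succ (var iVertex))) <|
  loop iRound <| loop iNext <|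
    when (edge (var iNext) (.read aPath (var aLength))) <|
    ite (eq (.read aVisited (var iNext)) (succ (var iVertex))) skip <|
    seq (set aLength (succ (var aLength))) <|
    seq (assign aPath (var aLength) (var iNext)) <|
    assign aVisited (var iNext) (succ (var iVertex))

/-- Find the largest index of an in-neighbour of the last vertex on the path. -/
def findEntry : ForProg :=
  loop iEntry <| when (lt (var iEntry) (var aLength)) <|
    when (edge (.read aPath (var iEntry)) (.read aPath (var aLength))) <|
    set aEntry (var iEntry)

/-- Colour all vertices. -/
def colourAll : ForProg :=
  loop iVertex <| seq buildPath <| seq findEntry <| seq (set aToken (var iVertex)) settle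

/-- Compute the offsets of the rows of the adjacency matrix. -/
def makeRows : ForProg :=
  loop iRow <| assign aRow (succ (var iRow)) (.add (.read aRow (var iRow)) (var aSize))

/-- Write the smaller colour class into the output. -/
def writeOutput : ForProg :=
  seq (set aCount (.const 0)) <|
  seq (loop iCount <| when (eq (.read aColour (var iCount)) (.const 1)) <|
    set aCount (succ (var aCount))) <|
  loop iOutput <| ite (lt (var aSize) (.add (var aCount) (var aCount)))
    (assign aOutput (var iOutput) (.sub (.read aColour (var iOutput)) (.const 1)))
    (assign aOutput (var iOutput) (.sub (.const 2) (.read aColour (var iOutput))))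

/-- The algorithm. -/
def main : ForProg := seq makeRows <| seq colourAll writeOutput

theorem isWellFormed_main : main.IsWellFormed := by decide

theorem run_when (e : Expr) (c : ForProg) (s : Store) :
    (when e c).run s = if e.eval s ≠ 0 then c.run s else s := rfl

theorem run_set (a : ℕ) (e : Expr) (s : Store) : (set a e).run s = s.write a 0 (e.eval s) := rfl

theorem run_assign (a : ℕ) (i e : Expr) (s : Store) :
    (assign a i e).run s = s.write a (i.eval s) (e.eval s) := rfl

end ForProg

/-- The store holds the number `n` of vertices, the adjacency matrix of `A`, and the offsets of its
rows. -/
structure HasGraph (A : ℕ → ℕ → Prop) (n : ℕ) (s : Store) : Prop where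
  size : s aSize 0 = n
  row : ∀ x < n, s aRow x = x * n
  adj : ∀ x < n, ∀ y < n, s aAdj (x * n + y) ≠ 0 ↔ A x y

/-- The colouring and the token in the store. -/
def config (s : Store) : DynMon.Config := (s aColour, s aToken 0)

/-! ### Correctness of the program -/

section Spec

open RAM.ForProg RAM.Expr

variable {A : ℕ → ℕ → Prop} {n : ℕ}

theorem HasGraph.of_eq {s s' : Store} (h : HasGraph A n s) (h0 : s' aSize = s aSize)
    (h1 : s' aAdj = s aAdj) (h2 : s' aRow = s aRow) : HasGraph A n s' :=
  ⟨by rw [h0]; exact h.size, by rw [h2]; exact h.row, by rw [h1]; exact h.adj⟩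

theorem HasGraph.run {s : Store} (h : HasGraph A n s) (c : ForProg) (h0 : aSize ∉ c.writes)
    (h1 : aAdj ∉ c.writes) (h2 : aRow ∉ c.writes) : HasGraph A n (c.run s) :=
  h.of_eq (run_of_notMem_writes h0 s) (run_of_notMem_writes h1 s) (run_of_notMem_writes h2 s)

theorem HasGraph.edge_iff {s : Store} (h : HasGraph A n s) {x y : Expr} (hx : x.eval s < n)
    (hy : y.eval s < n) : (edge x y).eval s ≠ 0 ↔ A (x.eval s) (y.eval s) := by
  rw [eval_edge, h.row _ hx]
  exact h.adj _ hx _ hy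

theorem run_countNbrs {s : Store} (h : HasGraph A n s) (ht : s aToken 0 < n) :
    countNbrs.run s aDegree 0 = (DynMon.inNbrs A n (s aToken 0)).card ∧
    countNbrs.run s aCountOne 0 = DynMon.colourCount A n (s aColour) 1 (s aToken 0) ∧
    countNbrs.run s aCountTwo 0 = DynMon.colourCount A n (s aColour) 2 (s aToken 0) := by
  rw [countNbrs, run_seq, run_seq, run_seq]
  generalize hs₀ : (set aCountTwo (.const 0)).run ((set aCountOne (.const 0)).run
    ((set aDegree (.const 0)).run s)) = s₀
  simp only [run_set] at hs₀
  have h₀ : HasGraph A n s₀ := h.of_eq (by subst hs₀; simp [Store.write_of_ne])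
    (by subst hs₀; simp [Store.write_of_ne]) (by subst hs₀; simp [Store.write_of_ne])
  refine run_loop h₀.size (fun k s' => s' aDegree 0 = (DynMon.inNbrs A k (s aToken 0)).card ∧
    s' aCountOne 0 = DynMon.colourCount A k (s aColour) 1 (s aToken 0) ∧
    s' aCountTwo 0 = DynMon.colourCount A k (s aColour) 2 (s aToken 0)) ?_ ?_
  · subst hs₀
    simp [Store.write_of_ne, Store.write_self, DynMon.inNbrs, DynMon.colourCount]
  · intro k hk s' hi hf ⟨h1, h2, h3⟩
    have hg : HasGraph A n s' := h₀.of_eq (hf _ (by decide)) (hf _ (by decide)) (hf _ (by decide))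
    have htok : s' aToken = s aToken := by
      rw [hf _ (by decide), ← hs₀]; simp [Store.write_of_ne]
    have hcol : s' aColour = s aColour := by
      rw [hf _ (by decide), ← hs₀]; simp [Store.write_of_ne]
    have hedge := hg.edge_iff (x := var iNbr) (y := var aToken) (by simpa [hi] using hk)
      (by simpa [htok] using ht)
    simp only [eval_var, hi, htok] at hedge
    rw [run_when]
    by_cases hA : A k (s aToken 0)
    · rw [if_pos (hedge.2 hA)]
      simp only [run_seq, run_set, run_when, eval_eq_ne_zero, eval_read, eval_var, eval_const,
        eval_succ, DynMon.colourCount_succ_of_adj hA, DynMon.inNbrs_succ_of_adj hA,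
        Finset.card_insert_of_notMem (DynMon.notMem_inNbrs k _)]
      by_cases c1 : s aColour k = 1
      · simp [c1, h1, h2, h3, hi, hcol, Store.write_of_ne, Store.write_self]
      · by_cases c2 : s aColour k = 2
        · simp [c2, h1, h2, h3, hi, hcol, Store.write_of_ne, Store.write_self]
        · simp [c1, c2, h1, h2, h3, hi, hcol, Store.write_of_ne, Store.write_self]
    · rw [if_neg (fun h => hA (hedge.1 h)), DynMon.colourCount_succ_of_not_adj hA,
        DynMon.colourCount_succ_of_not_adj hA, DynMon.inNbrs_succ_of_not_adj hA]
      simp [Store.write_of_ne, h1, h2, h3]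

/-- The program `ForProg.advance` carries out `DynMon.advance` on the configuration in the store. -/
theorem config_advance {s : Store} (h : HasGraph A n s) (ht : s aToken 0 < n)
    (hx : s aTarget 0 < n) :
    config (ForProg.advance.run s) = DynMon.advance A n (s aTarget 0) (config s) := by
  have hcol : countNbrs.run s aColour = s aColour := run_of_notMem_writes (by decide) s
  have htok : countNbrs.run s aToken = s aToken := run_of_notMem_writes (by decide) s
  have htar : countNbrs.run s aTarget = s aTarget := run_of_notMem_writes (by decide) s
  obtain ⟨h1, h2, h3⟩ := run_countNbrs h ht
  have hg := h.run countNbrs (by decide) (by decide) (by decide)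
  have hedge := hg.edge_iff (x := var aTarget) (y := var aToken) (by simpa [htar] using hx)
    (by simpa [htok] using ht)
  simp only [eval_var, htok, htar] at hedge
  rw [ForProg.advance, run_when, DynMon.advance]
  simp only [eval_eq_ne_zero, eval_read, eval_var, eval_const]
  have hs : config s = (s aColour, s aToken 0) := rfl
  simp only [hs]
  by_cases c0 : s aColour (s aToken 0) = 0
  swap
  · rw [if_neg c0, if_neg c0, hs]
  rw [if_pos c0, if_pos c0]
  simp only [run_seq, run_ite, run_when, run_assign, run_set, eval_lt_ne_zero, eval_add,
    eval_var, eval_const, eval_read, h1, h2, h3, hedge, ← two_mul]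
  split_ifs with d1 d2 d3 d4 d4
  all_goals first
    | exact absurd (hedge.1 d3) d4
    | exact absurd (hedge.2 d4) d3
    | simp [config, hcol, htok, htar, Store.write_of_ne, Store.write_self]

theorem config_write {s : Store} {a : ℕ} (h3 : aColour ≠ a) (h4 : aToken ≠ a) (i x : ℕ) :
    config (s.write a i x) = config s := by
  rw [config, config, Store.write_of_ne s h3, Store.write_of_ne s h4]

theorem config_tour {s : Store} (h : HasGraph A n s) (ht : s aToken 0 < n)
    (hX : ∀ i ≤ s aLength 0, s aPath i < n) :
    config (ForProg.tour.run s) =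
      DynMon.tour A n (s aPath) (s aLength 0) (s aStart 0) (config s) := by
  rw [ForProg.tour, run_seq, run_seq]
  generalize hc : (loop iSweep _ : ForProg) = c
  have hw : ∀ a, a ∉ c.writes → c.run s a = s a := fun a ha => run_of_notMem_writes ha s
  have key : config (c.run s) =
      DynMon.sweep A n (s aPath) (s aLength 0) (s aStart 0) n (config s) := by
    subst hc
    refine run_loop h.size (fun k s' => config s' =
      DynMon.sweep A n (s aPath) (s aLength 0) (s aStart 0) k (config s)) ?_ ?_
    · exact config_write (by decide) (by decide) _ _
    · intro k hk s' hi hf hq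
      have hlen : s' aLength = s aLength := hf _ (by decide)
      have hpath : s' aPath = s aPath := hf _ (by decide)
      have hstart : s' aStart = s aStart := hf _ (by decide)
      have hg : HasGraph A n s' :=
        h.of_eq (hf _ (by decide)) (hf _ (by decide)) (hf _ (by decide))
      rw [config_write (by decide) (by decide), DynMon.sweep, run_when, run_when]
      simp only [eval_lt_ne_zero, eval_var, eval_succ, hi, hlen, hstart, Nat.lt_succ_iff]
      by_cases c1 : s aStart 0 ≤ k
      swap
      · rw [if_neg c1, if_neg (fun h => c1 h.1), hq]
      by_cases c2 : k ≤ s aLength 0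
      swap
      · rw [if_pos c1, if_neg c2, if_neg (fun h => c2 h.2), hq]
      rw [if_pos c1, if_pos c2, if_pos ⟨c1, c2⟩, run_seq, run_set, ← hq]
      have htar : s'.write aTarget 0 ((Expr.read aPath (var iSweep)).eval s') aTarget 0 =
          s aPath k := by
        simp [Store.write_self, hi, hpath]
      rw [config_advance, htar, config_write (by decide) (by decide)]
      · exact hg.of_eq (Store.write_of_ne _ (by decide) _ _) (Store.write_of_ne _ (by decide) _ _)
          (Store.write_of_ne _ (by decide) _ _)
      · rw [Store.write_of_ne _ (by decide)]
        have := DynMon.sweep_snd_lt (A := A) hX (σ := config s) ht (s aStart 0) k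
        rw [← hq] at this
        exact this
      · rw [htar]
        exact hX k c2
  have hlen : c.run s aLength = s aLength := hw _ (by subst hc; decide)
  have hpath : c.run s aPath = s aPath := hw _ (by subst hc; decide)
  have hg : HasGraph A n (c.run s) :=
    h.run c (by subst hc; decide) (by subst hc; decide) (by subst hc; decide)
  rw [run_set, DynMon.tour, ← key]
  have htar : (c.run s).write aTarget 0 ((Expr.read aPath (var aLength)).eval (c.run s))
      aTarget 0 = s aPath (s aLength 0) := by
    simp [Store.write_self, hlen, hpath]
  rw [config_advance, htar, config_write (by decide) (by decide)]
  · exact hg.of_eq (Store.write_of_ne _ (by decide) _ _) (Store.write_of_ne _ (by decide) _ _)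
      (Store.write_of_ne _ (by decide) _ _)
  · rw [Store.write_of_ne _ (by decide)]
    have := DynMon.sweep_snd_lt (A := A) hX (σ := config s) ht (s aStart 0) n
    rw [← key] at this
    exact this
  · rw [htar]
    exact hX _ le_rfl

theorem HasGraph.write {s : Store} (h : HasGraph A n s) {a : ℕ} (h0 : aSize ≠ a) (h1 : aAdj ≠ a)
    (h2 : aRow ≠ a) (i x : ℕ) : HasGraph A n (s.write a i x) :=
  h.of_eq (s.write_of_ne h0 i x) (s.write_of_ne h1 i x) (s.write_of_ne h2 i x)

theorem config_tours {s : Store} (h : HasGraph A n s) (ht : s aToken 0 < n)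
    (hX : ∀ i ≤ s aLength 0, s aPath i < n) :
    config (tours.run s) =
      (DynMon.tour A n (s aPath) (s aLength 0) (s aEntry 0))^[n] (config s) := by
  refine run_loop h.size (fun k s' => config s' =
    (DynMon.tour A n (s aPath) (s aLength 0) (s aEntry 0))^[k] (config s)) ?_ ?_
  · exact config_write (by decide) (by decide) _ _
  · intro k hk s' hi hf hq
    have hlen : s' aLength = s aLength := hf _ (by decide)
    have hpath : s' aPath = s aPath := hf _ (by decide)
    have hentry : s' aEntry = s aEntry := hf _ (by decide)
    have hg : HasGraph A n s' := h.of_eq (hf _ (by decide)) (hf _ (by decide)) (hf _ (by decide))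
    have htok : s' aToken 0 < n := by
      have := DynMon.iterate_tour_snd_lt (A := A) hX (σ := config s) ht (s aEntry 0) k
      rwa [← hq] at this
    rw [config_write (by decide) (by decide), run_seq, run_set, config_tour
      (hg.write (by decide) (by decide) (by decide) _ _)
      (by rwa [Store.write_of_ne _ (by decide)])
      (by simpa [Store.write_of_ne, hlen, hpath] using hX), config_write (by decide) (by decide),
      hq, Function.iterate_succ_apply']
    simp [Store.write_of_ne, Store.write_self, hlen, hpath, hentry]

theorem config_detour {s : Store} (h : HasGraph A n s) (ht : s aToken 0 < n)
    (hX : ∀ i ≤ s aLength 0, s aPath i < n) :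
    config (ForProg.detour.run s) =
      DynMon.detour A n (s aPath) (s aLength 0) (s aEntry 0) (s iDetour 0) (config s) := by
  rw [ForProg.detour, run_when, DynMon.detour]
  simp only [eval_lt_ne_zero, eval_var]
  by_cases c1 : s iDetour 0 < s aLength 0
  swap
  · rw [if_neg c1, if_neg fun h => c1 h.1]
  rw [if_pos c1, run_when]
  have hedge := h.edge_iff (x := .read aPath (var iDetour)) (y := .read aPath (var aLength))
    (by simpa using hX _ c1.le) (by simpa using hX _ le_rfl)
  simp only [eval_read, eval_var] at hedge
  by_cases c2 : A (s aPath (s iDetour 0)) (s aPath (s aLength 0))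
  swap
  · rw [if_neg (fun h => c2 (hedge.1 h)), if_neg fun h => c2 h.2.1]
  rw [if_pos (hedge.2 c2), run_ite]
  simp only [eval_eq_ne_zero, eval_read, eval_var]
  by_cases c3 : s aColour (s aPath (s iDetour 0)) = s aColour (s aPath (s aEntry 0))
  · rw [if_pos c3, if_neg (fun h => h.2.2 c3)]
    rfl
  rw [if_neg c3, if_pos ⟨c1, c2, c3⟩, run_seq, run_seq, run_set]
  set s₁ := s.write aStart 0 ((var iDetour).eval s) with hs₁
  have hcfg : config s₁ = config s := config_write (by decide) (by decide) _ _
  have hg₁ : HasGraph A n s₁ := h.write (by decide) (by decide) (by decide) _ _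
  have hlen₁ : s₁ aLength = s aLength := s.write_of_ne (by decide) _ _
  have hpath₁ : s₁ aPath = s aPath := s.write_of_ne (by decide) _ _
  have hentry₁ : s₁ aEntry = s aEntry := s.write_of_ne (by decide) _ _
  have htok₁ : s₁ aToken = s aToken := s.write_of_ne (by decide) _ _
  have hstart₁ : s₁ aStart 0 = s iDetour 0 := by simp [hs₁, Store.write_self]
  have htour := config_tour hg₁ (by rwa [htok₁]) (by rwa [hlen₁, hpath₁])
  rw [hlen₁, hpath₁, hstart₁, hcfg] at htour
  have hlen₂ : ForProg.tour.run s₁ aLength = s aLength :=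
    (run_of_notMem_writes (by decide) _).trans hlen₁
  have hpath₂ : ForProg.tour.run s₁ aPath = s aPath :=
    (run_of_notMem_writes (by decide) _).trans hpath₁
  have hentry₂ : ForProg.tour.run s₁ aEntry = s aEntry :=
    (run_of_notMem_writes (by decide) _).trans hentry₁
  have htok₂ : ForProg.tour.run s₁ aToken 0 < n := by
    have := DynMon.tour_snd_lt (A := A) hX (σ := config s) ht (s iDetour 0)
    rwa [← htour] at this
  rw [config_tours (hg₁.run _ (by decide) (by decide) (by decide)) htok₂
    (by rwa [hlen₂, hpath₂]), hlen₂, hpath₂, hentry₂, htour]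

theorem config_settle {s : Store} (h : HasGraph A n s) (ht : s aToken 0 < n)
    (hX : ∀ i ≤ s aLength 0, s aPath i < n) :
    config (ForProg.settle.run s) =
      DynMon.settle A n (s aPath) (s aLength 0) (s aEntry 0) (config s) := by
  rw [ForProg.settle, run_seq, run_seq, run_seq, run_set, DynMon.settle]
  set s₁ := s.write aStart 0 ((const 0).eval s) with hs₁
  have hcfg : config s₁ = config s := config_write (by decide) (by decide) _ _
  have hg₁ : HasGraph A n s₁ := h.write (by decide) (by decide) (by decide) _ _
  have hlen₁ : s₁ aLength = s aLength := s.write_of_ne (by decide) _ _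
  have hpath₁ : s₁ aPath = s aPath := s.write_of_ne (by decide) _ _
  have hentry₁ : s₁ aEntry = s aEntry := s.write_of_ne (by decide) _ _
  have htok₁ : s₁ aToken = s aToken := s.write_of_ne (by decide) _ _
  have hstart₁ : s₁ aStart 0 = 0 := by simp [hs₁, Store.write_self]
  have htour := config_tour hg₁ (by rwa [htok₁]) (by rwa [hlen₁, hpath₁])
  rw [hlen₁, hpath₁, hstart₁, hcfg] at htour
  set s₂ := ForProg.tour.run s₁ with hs₂
  have hg₂ : HasGraph A n s₂ := hg₁.run _ (by decide) (by decide) (by decide)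
  have hlen₂ : s₂ aLength = s aLength := (run_of_notMem_writes (by decide) _).trans hlen₁
  have hpath₂ : s₂ aPath = s aPath := (run_of_notMem_writes (by decide) _).trans hpath₁
  have hentry₂ : s₂ aEntry = s aEntry := (run_of_notMem_writes (by decide) _).trans hentry₁
  have htok₂ : s₂ aToken 0 < n := by
    have := DynMon.tour_snd_lt (A := A) hX (σ := config s) ht 0
    rwa [← htour] at this
  have htours := config_tours hg₂ htok₂ (by rwa [hlen₂, hpath₂])
  rw [hlen₂, hpath₂, hentry₂, htour] at htours
  set s₃ := tours.run s₂ with hs₃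
  have hg₃ : HasGraph A n s₃ := hg₂.run _ (by decide) (by decide) (by decide)
  have hlen₃ : s₃ aLength = s aLength := (run_of_notMem_writes (by decide) _).trans hlen₂
  have hpath₃ : s₃ aPath = s aPath := (run_of_notMem_writes (by decide) _).trans hpath₂
  have hentry₃ : s₃ aEntry = s aEntry := (run_of_notMem_writes (by decide) _).trans hentry₂
  have htok₃ : (config s₃).2 < n := by
    rw [htours]
    exact DynMon.iterate_tour_snd_lt (A := A) hX
      (DynMon.tour_snd_lt (A := A) hX (σ := config s) ht 0) _ _
  rw [← htours]
  refine run_loop hg₃.size (fun k s' => config s' =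
    DynMon.detours A n (s aPath) (s aLength 0) (s aEntry 0) k (config s₃)) ?_ ?_
  · exact config_write (by decide) (by decide) _ _
  · intro k hk s' hi hf hq
    have hlen : s' aLength = s aLength := (hf _ (by decide)).trans hlen₃
    have hpath : s' aPath = s aPath := (hf _ (by decide)).trans hpath₃
    have hentry : s' aEntry = s aEntry := (hf _ (by decide)).trans hentry₃
    have hg : HasGraph A n s' := hg₃.of_eq (hf _ (by decide)) (hf _ (by decide)) (hf _ (by decide))
    have htok : s' aToken 0 < n := by
      have := DynMon.detours_snd_lt (A := A) hX htok₃ (s aEntry 0) k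
      rwa [← hq] at this
    rw [config_write (by decide) (by decide), config_detour hg htok (by rwa [hlen, hpath]), hlen,
      hpath, hentry, hi, hq, DynMon.detours]

/-- The state of the construction of the path for the vertex `u`. -/
structure IsPathState (A : ℕ → ℕ → Prop) (n u : ℕ) (s : Store) : Prop where
  zero : s aPath 0 = u
  lt : ∀ i ≤ s aLength 0, s aPath i < n
  inj : ∀ i ≤ s aLength 0, ∀ j ≤ s aLength 0, s aPath i = s aPath j → i = j
  adj : ∀ i < s aLength 0, A (s aPath (i + 1)) (s aPath i)
  visited_le : ∀ y < n, s aVisited y ≤ u + 1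
  visited_iff : ∀ y < n, s aVisited y = u + 1 ↔ ∃ i ≤ s aLength 0, s aPath i = y

theorem IsPathState.of_eq {u : ℕ} {s s' : Store} (h : IsPathState A n u s)
    (h0 : s' aPath = s aPath) (h1 : s' aLength = s aLength) (h2 : s' aVisited = s aVisited) :
    IsPathState A n u s' := by
  constructor
  · rw [h0]; exact h.zero
  · rw [h0, h1]; exact h.lt
  · rw [h0, h1]; exact h.inj
  · rw [h0, h1]; exact h.adj
  · rw [h2]; exact h.visited_le
  · rw [h0, h1, h2]; exact h.visited_iff

theorem IsPathState.length_lt {u : ℕ} {s : Store} (h : IsPathState A n u s) : s aLength 0 < n := by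
  have := Finset.card_le_card_of_injOn (s := Finset.range (s aLength 0 + 1)) (t := Finset.range n)
    (s aPath) (fun i hi => by
      simp only [Finset.coe_range, Set.mem_Iio] at hi ⊢
      exact h.lt i (by omega))
    (fun i hi j hj hij => by
      simp only [Finset.coe_range, Set.mem_Iio] at hi hj
      exact h.inj i (by omega) j (by omega) hij)
  simpa using this

/-- The path cannot be extended by a vertex less than `k`. -/
def IsExtensionFree (A : ℕ → ℕ → Prop) (k : ℕ) (s : Store) : Prop :=
  ∀ y < k, A y (s aPath (s aLength 0)) → ∃ i ≤ s aLength 0, s aPath i = y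

theorem IsExtensionFree.of_eq {k : ℕ} {s s' : Store} (h : IsExtensionFree A k s)
    (h0 : s' aPath = s aPath) (h1 : s' aLength = s aLength) : IsExtensionFree A k s' := by
  rw [IsExtensionFree, h0, h1]
  exact h

/-- The path may be extended by an unmarked vertex, which gets marked. -/
theorem IsPathState.push {u y : ℕ} {s s' : Store} (h : IsPathState A n u s) (hy : y < n)
    (hA : A y (s aPath (s aLength 0))) (hv : s aVisited y ≠ u + 1)
    (h0 : s' aPath = Function.update (s aPath) (s aLength 0 + 1) y)
    (h1 : s' aLength 0 = s aLength 0 + 1)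
    (h2 : s' aVisited = Function.update (s aVisited) y (u + 1)) : IsPathState A n u s' := by
  have hold : ∀ i ≤ s aLength 0, s' aPath i = s aPath i := fun i hi => by
    rw [h0, Function.update_of_ne (by omega)]
  have hnew : s' aPath (s aLength 0 + 1) = y := by rw [h0, Function.update_self]
  have hnot : ∀ i ≤ s aLength 0, s aPath i ≠ y := fun i hi hiy =>
    hv ((h.visited_iff y hy).2 ⟨i, hi, hiy⟩)
  constructor
  · rw [hold 0 (Nat.zero_le _)]; exact h.zero
  · intro i hi
    rcases Nat.lt_or_ge (s aLength 0) i with hil | hil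
    · rw [show i = s aLength 0 + 1 by omega, hnew]; exact hy
    · rw [hold i hil]; exact h.lt i hil
  · intro i hi j hj hij
    rcases Nat.lt_or_ge (s aLength 0) i with hil | hil <;>
      rcases Nat.lt_or_ge (s aLength 0) j with hjl | hjl
    · omega
    · rw [show i = s aLength 0 + 1 by omega, hnew, hold j hjl] at hij
      exact absurd hij.symm (hnot j hjl)
    · rw [show j = s aLength 0 + 1 by omega, hnew, hold i hil] at hij
      exact absurd hij (hnot i hil)
    · rw [hold i hil, hold j hjl] at hij
      exact h.inj i hil j hjl hij
  · intro i hi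
    rcases Nat.lt_or_ge i (s aLength 0) with hil | hil
    · rw [hold i hil.le, hold (i + 1) hil]; exact h.adj i hil
    · rw [show i = s aLength 0 by omega, hold _ le_rfl, hnew]; exact hA
  · intro w hw
    rw [h2]
    rcases eq_or_ne w y with rfl | hwy
    · rw [Function.update_self]
    · rw [Function.update_of_ne hwy]; exact h.visited_le w hw
  · intro w hw
    rw [h2, h1]
    rcases eq_or_ne w y with rfl | hwy
    · rw [Function.update_self]
      exact ⟨fun _ => ⟨_, le_rfl, hnew⟩, fun _ => rfl⟩
    · rw [Function.update_of_ne hwy, h.visited_iff w hw]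
      constructor
      · rintro ⟨i, hi, hiw⟩
        exact ⟨i, by omega, by rw [hold i hi, hiw]⟩
      · rintro ⟨i, hi, hiw⟩
        rcases Nat.lt_or_ge (s aLength 0) i with hil | hil
        · rw [show i = s aLength 0 + 1 by omega, hnew] at hiw
          exact absurd hiw.symm hwy
        · exact ⟨i, hil, by rw [← hold i hil, hiw]⟩

/-- Every round extends the path, unless it cannot be extended any more. -/
theorem isPathState_round {u : ℕ} {s : Store} (h : HasGraph A n s) (hu : s iVertex 0 = u)
    (hp : IsPathState A n u s) {c : ForProg}
    (hc : c = loop iNext (when (edge (var iNext) (.read aPath (var aLength)))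
      (ite (eq (.read aVisited (var iNext)) (succ (var iVertex))) skip
      (seq (set aLength (succ (var aLength)))
      (seq (assign aPath (var aLength) (var iNext))
      (assign aVisited (var iNext) (succ (var iVertex)))))))) :
    IsPathState A n u (c.run s) ∧ s aLength 0 ≤ c.run s aLength 0 ∧
      (IsExtensionFree A n s → IsExtensionFree A n (c.run s)) ∧
      (c.run s aLength 0 = s aLength 0 → IsExtensionFree A n (c.run s)) := by
  subst hc
  refine run_loop h.size (fun k s' => IsPathState A n u s' ∧ s aLength 0 ≤ s' aLength 0 ∧
      (IsExtensionFree A n s → IsExtensionFree A n s') ∧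
      (s' aLength 0 = s aLength 0 → IsExtensionFree A k s')) ?_ ?_
  · have h5 : s.write iNext 0 0 aPath = s aPath := s.write_of_ne (by decide) _ _
    have h6 : s.write iNext 0 0 aVisited = s aVisited := s.write_of_ne (by decide) _ _
    have h7 : s.write iNext 0 0 aLength = s aLength := s.write_of_ne (by decide) _ _
    exact ⟨hp.of_eq h5 h7 h6, by rw [h7], fun h => h.of_eq h5 h7,
      fun _ y hy => absurd hy (Nat.not_lt_zero y)⟩
  · rintro k hk s' hi hf ⟨hp', hle, hmax, hfree⟩
    have hg : HasGraph A n s' := h.of_eq (hf _ (by decide)) (hf _ (by decide)) (hf _ (by decide))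
    have hu' : s' iVertex 0 = u := by rw [hf _ (by decide), hu]
    have hedge := hg.edge_iff (x := var iNext) (y := .read aPath (var aLength))
      (by simpa [hi] using hk) (by simpa using hp'.lt _ le_rfl)
    simp only [eval_read, eval_var, hi] at hedge
    -- Without an extension the invariant advances by one vertex.
    have stay : (A k (s' aPath (s' aLength 0)) → ∃ i ≤ s' aLength 0, s' aPath i = k) →
        ∀ s'' : Store, s'' = s'.write iNext 0 (k + 1) → IsPathState A n u s'' ∧
          s aLength 0 ≤ s'' aLength 0 ∧ (IsExtensionFree A n s → IsExtensionFree A n s'') ∧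
          (s'' aLength 0 = s aLength 0 → IsExtensionFree A (k + 1) s'') := by
      rintro hk' s'' rfl
      have h5 : s'.write iNext 0 (k + 1) aPath = s' aPath := s'.write_of_ne (by decide) _ _
      have h6 : s'.write iNext 0 (k + 1) aVisited = s' aVisited := s'.write_of_ne (by decide) _ _
      have h7 : s'.write iNext 0 (k + 1) aLength = s' aLength := s'.write_of_ne (by decide) _ _
      refine ⟨hp'.of_eq h5 h7 h6, by rwa [h7], fun h => (hmax h).of_eq h5 h7, fun hl => ?_⟩
      refine IsExtensionFree.of_eq (s := s') (fun y hy hA => ?_) h5 h7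
      rcases Nat.lt_succ_iff_lt_or_eq.1 hy with hy | rfl
      · exact hfree (by rwa [h7] at hl) y hy hA
      · exact hk' hA
    rw [run_when]
    by_cases c1 : A k (s' aPath (s' aLength 0))
    swap
    · rw [if_neg (fun h => c1 (hedge.1 h))]
      exact stay (fun h => absurd h c1) _ rfl
    rw [if_pos (hedge.2 c1), run_ite]
    simp only [eval_eq_ne_zero, eval_read, eval_var, eval_succ, hi, hu']
    by_cases c2 : s' aVisited k = u + 1
    · rw [if_pos c2]
      exact stay (fun _ => (hp'.visited_iff k hk).1 c2) _ rfl
    rw [if_neg c2]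
    generalize hs'' : Store.write (ForProg.run _ s') iNext 0 (k + 1) = s''
    simp only [run_seq, run_set, run_assign, eval_var, eval_succ] at hs''
    have h5 : s'' aPath = Function.update (s' aPath) (s' aLength 0 + 1) k := by
      subst hs''; simp [Store.write_of_ne, Store.write_self, hi]
    have h6 : s'' aVisited = Function.update (s' aVisited) k (u + 1) := by
      subst hs''; simp [Store.write_of_ne, Store.write_self, hi, hu']
    have h7 : s'' aLength 0 = s' aLength 0 + 1 := by
      subst hs''; simp [Store.write_of_ne, Store.write_self]
    refine ⟨hp'.push hk c1 c2 h5 h7 h6, by omega, fun h => ?_, fun h => by omega⟩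
    exact absurd ((hp'.visited_iff k hk).2 (hmax h k hk c1)) c2

/-- After `n` rounds the path is maximal, for it cannot have more than `n` vertices. -/
theorem run_buildPath {u : ℕ} {s : Store} (h : HasGraph A n s) (hu : s iVertex 0 = u) (hun : u < n)
    (hirr : ∀ v, ¬ A v v) (hlt : ∀ u v, A u v → u < n) (hv : ∀ y < n, s aVisited y ≤ u) :
    DynMon.IsMaximalPath A n (buildPath.run s aPath) (buildPath.run s aLength 0) ∧
      buildPath.run s aLength 0 < n ∧ buildPath.run s aPath 0 = u ∧
      ∀ y < n, buildPath.run s aVisited y ≤ u + 1 := by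
  suffices hs : IsPathState A n u (buildPath.run s) ∧
      (n ≤ buildPath.run s aLength 0 ∨ IsExtensionFree A n (buildPath.run s)) by
    obtain ⟨hp, hfree⟩ := hs
    have hl := hp.length_lt
    refine ⟨⟨hp.lt, hp.inj, hp.adj, fun y hy => ?_⟩, hl, hp.zero, hp.visited_le⟩
    obtain ⟨i, hi, rfl⟩ := hfree.resolve_left (by omega) y (hlt _ _ hy) hy
    refine ⟨i, lt_of_le_of_ne hi ?_, rfl⟩
    rintro rfl
    exact hirr _ hy
  rw [buildPath, run_seq, run_seq, run_seq]
  generalize hs₀ : ForProg.run (assign aVisited _ _) _ = s₀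
  simp only [run_set, run_assign, eval_var, eval_succ, eval_const] at hs₀
  have hg : HasGraph A n s₀ := h.of_eq (by subst hs₀; simp [Store.write_of_ne])
    (by subst hs₀; simp [Store.write_of_ne]) (by subst hs₀; simp [Store.write_of_ne])
  have hu₀ : s₀ iVertex 0 = u := by subst hs₀; simp [Store.write_of_ne, hu]
  have h5 : s₀ aPath = Function.update (s aPath) 0 u := by
    subst hs₀; simp [Store.write_of_ne, Store.write_self, hu]
  have h6 : s₀ aVisited = Function.update (s aVisited) u (u + 1) := by
    subst hs₀; simp [Store.write_of_ne, Store.write_self, hu]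
  have h7 : s₀ aLength 0 = 0 := by
    subst hs₀; simp [Store.write_of_ne, Store.write_self]
  have hp₀ : IsPathState A n u s₀ := by
    constructor
    · rw [h5, Function.update_self]
    · intro i hi
      rw [show i = 0 by omega, h5, Function.update_self]; exact hun
    · intro i hi j hj _; omega
    · intro i hi; omega
    · intro y hy
      rw [h6]
      rcases eq_or_ne y u with rfl | hyu
      · rw [Function.update_self]
      · rw [Function.update_of_ne hyu]; exact (hv y hy).trans (Nat.le_succ u)
    · intro y hy
      rw [h6, h7, h5]
      rcases eq_or_ne y u with rfl | hyu
      · simp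
      · rw [Function.update_of_ne hyu]
        have := hv y hy
        constructor
        · intro h; omega
        · rintro ⟨i, hi, hiy⟩
          rw [Nat.le_zero.1 hi, Function.update_self] at hiy
          exact absurd hiy.symm hyu
  refine run_loop hg.size (fun k s' => IsPathState A n u s' ∧
    (k ≤ s' aLength 0 ∨ IsExtensionFree A n s')) ?_ ?_
  · exact ⟨hp₀.of_eq (s₀.write_of_ne (by decide) _ _) (s₀.write_of_ne (by decide) _ _)
      (s₀.write_of_ne (by decide) _ _), Or.inl (Nat.zero_le _)⟩
  · rintro k hk s' hi hf ⟨hp, hor⟩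
    obtain ⟨h1, h2, h3, h4⟩ := isPathState_round
      (hg.of_eq (hf _ (by decide)) (hf _ (by decide)) (hf _ (by decide)))
      (by rw [hf _ (by decide), hu₀]) hp rfl
    refine ⟨h1.of_eq (Store.write_of_ne _ (by decide) _ _) (Store.write_of_ne _ (by decide) _ _)
      (Store.write_of_ne _ (by decide) _ _), ?_⟩
    rw [Store.write_of_ne _ (by decide)]
    rcases h2.lt_or_eq with hlt' | heq
    · rcases hor with hor | hor
      · exact Or.inl (by omega)
      · exact Or.inr ((h3 hor).of_eq (Store.write_of_ne _ (by decide) _ _)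
          (Store.write_of_ne _ (by decide) _ _))
    · exact Or.inr ((h4 heq.symm).of_eq (Store.write_of_ne _ (by decide) _ _)
          (Store.write_of_ne _ (by decide) _ _))

/-- The entry found is the largest one: it is at least every index `r` of an in-neighbour, and it is
the index of an in-neighbour itself as soon as there is one. -/
theorem run_findEntry {s : Store} (h : HasGraph A n s) (hl : s aLength 0 < n)
    (hX : ∀ i ≤ s aLength 0, s aPath i < n) :
    ∀ r < s aLength 0, A (s aPath r) (s aPath (s aLength 0)) →
      r ≤ findEntry.run s aEntry 0 ∧ findEntry.run s aEntry 0 < s aLength 0 ∧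
      A (s aPath (findEntry.run s aEntry 0)) (s aPath (s aLength 0)) := by
  suffices hs : ∀ r < n, r < s aLength 0 → A (s aPath r) (s aPath (s aLength 0)) →
      r ≤ findEntry.run s aEntry 0 ∧ findEntry.run s aEntry 0 < s aLength 0 ∧
      A (s aPath (findEntry.run s aEntry 0)) (s aPath (s aLength 0)) from
    fun r hr => hs r (by omega) hr
  refine run_loop h.size (fun k s' => ∀ r < k, r < s aLength 0 →
    A (s aPath r) (s aPath (s aLength 0)) → r ≤ s' aEntry 0 ∧ s' aEntry 0 < s aLength 0 ∧
      A (s aPath (s' aEntry 0)) (s aPath (s aLength 0))) ?_ ?_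
  · intro r hr
    omega
  · intro k hk s' hi hf hq
    have hlen : s' aLength = s aLength := hf _ (by decide)
    have hpath : s' aPath = s aPath := hf _ (by decide)
    have hg : HasGraph A n s' := h.of_eq (hf _ (by decide)) (hf _ (by decide)) (hf _ (by decide))
    rw [Store.write_of_ne _ (by decide), run_when, run_when]
    simp only [eval_lt_ne_zero, eval_var, hi, hlen]
    have keep : ¬ (k < s aLength 0 ∧ A (s aPath k) (s aPath (s aLength 0))) →
        ∀ r < k + 1, r < s aLength 0 → A (s aPath r) (s aPath (s aLength 0)) →
          r ≤ s' aEntry 0 ∧ s' aEntry 0 < s aLength 0 ∧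
          A (s aPath (s' aEntry 0)) (s aPath (s aLength 0)) := by
      intro hk' r hr hrl hA
      rcases Nat.lt_succ_iff_lt_or_eq.1 hr with hr | rfl
      · exact hq r hr hrl hA
      · exact absurd ⟨hrl, hA⟩ hk'
    by_cases c1 : k < s aLength 0
    swap
    · rw [if_neg c1]
      exact keep fun h => c1 h.1
    have hedge := hg.edge_iff (x := .read aPath (var iEntry)) (y := .read aPath (var aLength))
      (by simpa [hi, hpath] using hX _ c1.le) (by simpa [hlen, hpath] using hX _ le_rfl)
    simp only [eval_read, eval_var, hi, hlen, hpath] at hedge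
    by_cases c2 : A (s aPath k) (s aPath (s aLength 0))
    swap
    · rw [if_pos c1, if_neg (fun h => c2 (hedge.1 h))]
      exact keep fun h => c2 h.2
    rw [if_pos c1, if_pos (hedge.2 c2), run_set, Store.write_self, Function.update_self, eval_var,
      hi]
    exact fun r hr _ _ => ⟨Nat.lt_succ_iff.1 hr, c1, c2⟩

/-- The algorithm finds a colouring of all vertices with two degenerate colour classes. -/
theorem run_colourAll {s : Store} (h : HasGraph A n s) (hirr : ∀ v, ¬ A v v)
    (hasymm : ∀ u v, A u v → ¬ A v u) (hlt : ∀ u v, A u v → u < n)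
    (hdeg : ∀ v < n, ∃ u, A u v) (hcol : ∀ v, s aColour v = 0) (hvis : ∀ v, s aVisited v = 0) :
    (∀ v < n, colourAll.run s aColour v = 1 ∨ colourAll.run s aColour v = 2) ∧
      ∀ c, c = 1 ∨ c = 2 → DynMon.IsDegenerate A n (colourAll.run s aColour) c := by
  suffices hs : (∀ v < n, colourAll.run s aColour v ≠ 0) ∧
      (∀ v < n, colourAll.run s aColour v ≤ 2) ∧
      (∀ c, c = 1 ∨ c = 2 → DynMon.IsDegenerate A n (colourAll.run s aColour) c) ∧
      ∀ y < n, colourAll.run s aVisited y ≤ n by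
    refine ⟨fun v hv => ?_, hs.2.2.1⟩
    have h1 := hs.1 v hv
    have h2 := hs.2.1 v hv
    omega
  refine run_loop h.size (fun u s' => (∀ v < u, s' aColour v ≠ 0) ∧
      (∀ v < n, s' aColour v ≤ 2) ∧
      (∀ c, c = 1 ∨ c = 2 → DynMon.IsDegenerate A n (s' aColour) c) ∧
      ∀ y < n, s' aVisited y ≤ u) ?_ ?_
  · rw [Store.write_of_ne _ (by decide), Store.write_of_ne _ (by decide)]
    refine ⟨fun v hv => absurd hv (Nat.not_lt_zero v), fun v _ => by rw [hcol]; omega,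
      fun c hc W ⟨v, hv⟩ hW => ?_, fun y _ => by rw [hvis]⟩
    have := (hW v hv).2
    rw [hcol] at this
    omega
  · rintro u hu s' hi hf ⟨q1, q2, q3, q4⟩
    have hg : HasGraph A n s' := h.of_eq (hf _ (by decide)) (hf _ (by decide)) (hf _ (by decide))
    rw [Store.write_of_ne _ (by decide), Store.write_of_ne _ (by decide), run_seq, run_seq,
      run_seq, run_set]
    obtain ⟨hX, hl, hX0, hvis'⟩ := run_buildPath hg hi hu hirr hlt q4
    set s₁ := buildPath.run s' with hs₁
    have hg₁ : HasGraph A n s₁ := hg.run _ (by decide) (by decide) (by decide)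
    have hentry := run_findEntry hg₁ hl hX.lt
    set s₂ := findEntry.run s₁ with hs₂
    have hpath₂ : s₂ aPath = s₁ aPath := run_of_notMem_writes (by decide) _
    have hlen₂ : s₂ aLength = s₁ aLength := run_of_notMem_writes (by decide) _
    have hcol₂ : s₂ aColour = s' aColour :=
      (run_of_notMem_writes (by decide) _).trans (run_of_notMem_writes (by decide) _)
    have hvert₂ : s₂ iVertex 0 = u := by
      rw [hs₂, run_of_notMem_writes (by decide), hs₁, run_of_notMem_writes (by decide), hi]
    have hg₂ : HasGraph A n s₂ := hg₁.run _ (by decide) (by decide) (by decide)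
    set s₃ := s₂.write aToken 0 ((var iVertex).eval s₂) with hs₃
    have hcfg : config s₃ = (s' aColour, u) := by
      simp [config, hs₃, Store.write_of_ne, Store.write_self, hcol₂, hvert₂]
    have hpath₃ : s₃ aPath = s₁ aPath := (Store.write_of_ne _ (by decide) _ _).trans hpath₂
    have hlen₃ : s₃ aLength = s₁ aLength := (Store.write_of_ne _ (by decide) _ _).trans hlen₂
    have hentry₃ : s₃ aEntry = s₂ aEntry := Store.write_of_ne _ (by decide) _ _
    have htok₃ : s₃ aToken 0 < n := by
      have : s₃ aToken 0 = (config s₃).2 := rfl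
      rw [this, hcfg]
      exact hu
    have hg₃ : HasGraph A n s₃ := hg₂.write (by decide) (by decide) (by decide) _ _
    have hset := config_settle hg₃ htok₃
      (by rw [hpath₃, hlen₃]; exact hX.lt)
    rw [hpath₃, hlen₃, hentry₃, hcfg] at hset
    have hvalid : DynMon.IsValid A n u (s' aColour, u) := by
      refine ⟨hu, q3, q2, fun v hv hv0 => ?_⟩
      rcases Nat.lt_succ_iff_lt_or_eq.1 hv with hv | rfl
      · exact absurd hv0 (q1 v hv)
      · rfl
    obtain ⟨y, hy⟩ := hdeg _ (hX.lt _ le_rfl)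
    obtain ⟨r, hr, rfl⟩ := hX.maximal y hy
    obtain ⟨-, hj, hA⟩ := hentry r hr hy
    have hclosed := DynMon.not_isOpen_settle hirr hasymm hX hl hj hA
      (fun r hr hA => (hentry r hr hA).1) (σ := (s' aColour, u)) hX0.symm
    have hvalid' := hvalid.settle (X := s₁ aPath) (l := s₁ aLength 0) (j := s₂ aEntry 0) hirr hlt
    rw [← hset] at hclosed hvalid'
    refine ⟨fun v hv hv0 => hclosed ?_, hvalid'.le, hvalid'.degenerate, fun y hy => ?_⟩
    · have := hvalid'.coloured v hv hv0
      rw [DynMon.IsOpen, ← this]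
      exact hv0
    · have : settle.run s₃ aVisited = s₁ aVisited :=
        (run_of_notMem_writes (by decide) _).trans ((Store.write_of_ne _ (by decide) _ _).trans
          (run_of_notMem_writes (by decide) _))
      rw [this]
      exact hvis' y hy

/-- The offset of the row `x` is `x * n`, obtained by repeated addition. -/
theorem run_makeRows {s : Store} (hn : s aSize 0 = n) (h0 : s aRow 0 = 0) :
    ∀ x ≤ n, makeRows.run s aRow x = x * n := by
  refine run_loop hn (fun k s' => ∀ x ≤ k, s' aRow x = x * n) ?_ ?_
  · intro x hx
    rw [Store.write_of_ne _ (by decide), Nat.le_zero.1 hx, h0, Nat.zero_mul]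
  · intro k hk s' hi hf hq x hx
    have hsize : s' aSize 0 = n := by rw [hf _ (by decide), hn]
    rw [Store.write_of_ne _ (by decide), run_assign, Store.write_self]
    simp only [eval_succ, eval_var, eval_add, eval_read, hi, hsize]
    rcases hx.lt_or_eq with hx | rfl
    · rw [Function.update_of_ne (by omega), hq x (by omega)]
    · rw [Function.update_self, hq k le_rfl, Nat.succ_mul]

/-- With colours `1` and `2` only, the output is the class `2` if more than half of the vertices
have colour `1`, and the class `1` otherwise. -/
theorem run_writeOutput {s : Store} (hn : s aSize 0 = n) :
    ∀ v < n, writeOutput.run s aOutput v =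
      if n < 2 * ((Finset.range n).filter fun u => s aColour u = 1).card then s aColour v - 1
      else 2 - s aColour v := by
  rw [writeOutput, run_seq, run_seq]
  generalize hc : (loop iCount _ : ForProg) = c
  have hcount : c.run ((set aCount (.const 0)).run s) aCount 0 =
      ((Finset.range n).filter fun u => s aColour u = 1).card := by
    subst hc
    refine run_loop (n := n) (by rw [run_set, Store.write_of_ne _ (by decide), hn]) (fun k s' =>
      s' aCount 0 = ((Finset.range k).filter fun u => s aColour u = 1).card) ?_ ?_
    · simp [run_set, Store.write_of_ne, Store.write_self]
    · intro k hk s' hi hf hq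
      have hcol : s' aColour = s aColour :=
        (hf _ (by decide)).trans (s.write_of_ne (by decide) _ _)
      rw [Store.write_of_ne _ (by decide), run_when, Finset.range_add_one, Finset.filter_insert]
      simp only [eval_eq_ne_zero, eval_read, eval_var, eval_const, hi, hcol]
      split_ifs with hk1
      · rw [run_set, Store.write_self, Finset.card_insert_of_notMem (by simp)]
        simp [hq]
      · exact hq
  have hcol : c.run ((set aCount (.const 0)).run s) aColour = s aColour := by
    subst hc
    exact (run_of_notMem_writes (by decide) _).trans (s.write_of_ne (by decide) _ _)
  have hsize : c.run ((set aCount (.const 0)).run s) aSize 0 = n := by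
    subst hc
    rw [run_of_notMem_writes (by decide), run_set, Store.write_of_ne _ (by decide), hn]
  generalize c.run ((set aCount (.const 0)).run s) = s₁ at hcount hcol hsize
  refine run_loop hsize (fun k s' => ∀ v < k, s' aOutput v =
      if n < 2 * ((Finset.range n).filter fun u => s aColour u = 1).card then s aColour v - 1
      else 2 - s aColour v) ?_ ?_
  · intro v hv
    omega
  · intro k hk s' hi hf hq v hv
    have hcol' : s' aColour = s aColour := (hf _ (by decide)).trans hcol
    have hsize' : s' aSize 0 = n := by rw [hf _ (by decide), hsize]
    have hcount' := hcount
    rw [← hf _ (by decide : aCount ∉ _)] at hcount'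
    rw [Store.write_of_ne _ (by decide), run_ite]
    simp only [eval_lt_ne_zero, eval_add, eval_var, hsize', hcount', ← two_mul, run_assign]
    rcases Nat.lt_succ_iff_lt_or_eq.1 hv with hv | rfl
    · have := hq v hv
      split_ifs at this ⊢ <;>
        rw [Store.write_self, hi, Function.update_of_ne hv.ne, this]
    · split_ifs <;> simp [Store.write_self, hi, hcol']

end Spec

theorem inputStore_adj {n : ℕ} (G : Digraph (Fin n)) {x y : ℕ} (hx : x < n) (hy : y < n) :
    inputStore G aAdj (x * n + y) ≠ 0 ↔ DynMon.natAdj G x y := by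
  simp only [inputStore, one_ne_zero, false_and, if_false, true_and]
  constructor
  · intro h
    split_ifs at h with h'
    · obtain ⟨-, u, v, huv, hA⟩ := h'
      have hn : 0 < n := by omega
      have h1 : y = v := by
        have := congrArg (· % n) huv
        simpa [Nat.mul_add_mod', Nat.mod_eq_of_lt hy, Nat.mod_eq_of_lt v.2] using this
      have h2 : x = u := by
        rw [h1] at huv
        exact Nat.eq_of_mul_eq_mul_right hn (Nat.add_right_cancel huv)
      exact ⟨hx, hy, by convert hA⟩
    · exact absurd rfl h
  · rintro ⟨_, _, hA⟩
    rw [if_pos ⟨rfl, ⟨x, hx⟩, ⟨y, hy⟩, rfl, hA⟩]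
    exact one_ne_zero

theorem map_outputSet (n : ℕ) (s : Store) :
    (outputSet n s).map Fin.valEmbedding = (Finset.range n).filter fun v => s aOutput v ≠ 0 := by
  ext x
  simp only [outputSet, Finset.mem_map, Finset.mem_filter, Finset.mem_univ, true_and,
    Finset.mem_range, Fin.valEmbedding_apply]
  constructor
  · rintro ⟨u, h, rfl⟩
    exact ⟨u.2, h⟩
  · rintro ⟨hx, h⟩
    exact ⟨⟨x, hx⟩, h, rfl⟩

end RAM

theorem mainTheorem8 :
    ∃ (A : RAM.Prog) (p : Polynomial ℕ),
      ∀ (n : ℕ) (G : Digraph (Fin n)), DynMon.IsSimple G → (∀ v, 1 ≤ DynMon.inDegree G v) →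
        ∃ (s : RAM.Store) (t : ℕ),
          RAM.Exec A (RAM.inputStore G) s t ∧
          t ≤ p.eval n ∧
          DynMon.IsStrictMajorityDynamo G (RAM.outputSet n s) ∧
          ((RAM.outputSet n s).card : ℚ) ≤ (n : ℚ) / 2 := by
  refine ⟨RAM.ForProg.main.toProg, RAM.ForProg.main.time, fun n G hG hdeg => ?_⟩
  obtain ⟨t, ht, hexec⟩ := RAM.ForProg.isWellFormed_main.exec (RAM.inputStore G)
  refine ⟨_, t, hexec, by simpa [RAM.inputStore] using ht, ?_⟩
  have hirr : ∀ v, ¬ DynMon.natAdj G v v := fun v ⟨hv, _, h⟩ => hG.no_loop _ h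
  have hasymm : ∀ u v, DynMon.natAdj G u v → ¬ DynMon.natAdj G v u :=
    fun u v ⟨_, _, h⟩ ⟨_, _, h'⟩ => hG.no_two_cycle _ _ h h'
  have hlt : ∀ u v, DynMon.natAdj G u v → u < n := fun u v ⟨h, _, _⟩ => h
  have hdeg' : ∀ v < n, ∃ u, DynMon.natAdj G u v := fun v hv => by
    have := hdeg ⟨v, hv⟩
    rw [DynMon.inDegree_eq_card] at this
    obtain ⟨u, hu⟩ := Finset.card_pos.1 this
    simp only [DynMon.inNbrs, Finset.mem_filter] at hu
    exact ⟨u, hu.2⟩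
  rw [RAM.ForProg.main, RAM.ForProg.run_seq, RAM.ForProg.run_seq]
  set s₀ := RAM.inputStore G with hs₀
  have hsize₀ : s₀ 0 0 = n := by simp [hs₀, RAM.inputStore]
  have hrow := RAM.run_makeRows hsize₀ (by simp [hs₀, RAM.inputStore])
  set s₁ := RAM.ForProg.makeRows.run s₀ with hs₁
  have hkeep : ∀ a ∉ RAM.ForProg.makeRows.writes, s₁ a = s₀ a := fun a ha =>
    RAM.ForProg.run_of_notMem_writes ha s₀
  have hg : RAM.HasGraph (DynMon.natAdj G) n s₁ :=
    ⟨by rw [hkeep _ (by decide), hsize₀], fun x hx => hrow x hx.le, fun x hx y hy => by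
      rw [hkeep _ (by decide)]; exact RAM.inputStore_adj G hx hy⟩
  obtain ⟨hcol, hdegen⟩ := RAM.run_colourAll hg hirr hasymm hlt hdeg'
    (fun v => by rw [hkeep _ (by decide)]; simp [hs₀, RAM.inputStore])
    (fun v => by rw [hkeep _ (by decide)]; simp [hs₀, RAM.inputStore])
  have hg₂ := hg.run RAM.ForProg.colourAll (by decide) (by decide) (by decide)
  have hout := RAM.run_writeOutput hg₂.size
  set s₂ := RAM.ForProg.colourAll.run s₁ with hs₂
  set s₃ := RAM.ForProg.writeOutput.run s₂ with hs₃
  have hcard := congrArg Finset.card (RAM.map_outputSet n s₃)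
  rw [Finset.card_map] at hcard
  set m := ((Finset.range n).filter fun u => s₂ 3 u = 1).card with hm
  have hcompl : m + ((Finset.range n).filter fun u => ¬ s₂ 3 u = 1).card = n := by
    rw [hm, Finset.card_filter_add_card_filter_not, Finset.card_range]
  have hmem : ∀ v : Fin n, v ∉ RAM.outputSet n s₃ → s₃ 2 v = 0 := fun v hv => by
    simpa [RAM.outputSet] using hv
  -- The output is the smaller class, and its complement is the other class.
  have hhalf : ((RAM.outputSet n s₃).card : ℚ) ≤ (n : ℚ) / 2 ↔
      2 * (RAM.outputSet n s₃).card ≤ n := by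
    rw [le_div_iff₀ two_pos, mul_comm]
    exact_mod_cast Iff.rfl
  rw [hhalf]
  rcases Nat.lt_or_ge n (2 * m) with hlarge | hsmall
  · simp only [if_pos hlarge] at hout
    refine ⟨DynMon.isStrictMajorityDynamo_of_isDegenerate G (hdegen 1 (Or.inl rfl)) _
      fun v hv => ?_, ?_⟩
    · have h1 := hmem v hv
      rw [hout v v.2] at h1
      have := hcol v v.2
      omega
    · have : (Finset.range n).filter (fun v => s₃ 2 v ≠ 0) =
          (Finset.range n).filter fun u => ¬ s₂ 3 u = 1 := by
        refine Finset.filter_congr fun v hv => ?_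
        rw [hout v (Finset.mem_range.1 hv)]
        have := hcol v (Finset.mem_range.1 hv)
        omega
      rw [this] at hcard
      omega
  · simp only [if_neg (not_lt.2 hsmall)] at hout
    refine ⟨DynMon.isStrictMajorityDynamo_of_isDegenerate G (hdegen 2 (Or.inr rfl)) _
      fun v hv => ?_, ?_⟩
    · have h1 := hmem v hv
      rw [hout v v.2] at h1
      have := hcol v v.2
      omega
    · have : (Finset.range n).filter (fun v => s₃ 2 v ≠ 0) =
          (Finset.range n).filter fun u => s₂ 3 u = 1 := by
        refine Finset.filter_congr fun v hv => ?_
        rw [hout v (Finset.mem_range.1 hv)]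
        have := hcol v (Finset.mem_range.1 hv)
        omega
      rw [this] at hcard
      omega
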